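/- **Setting.** Dyadic intervals are the intervals $[k2^j,(k+1)2^j)$ with $j,k\in\mathbb Z$; $c(I)$ and $|I|$ denote the midpoint and the length of $I$, and $aI$ is the closed interval with midpoint $c(I)$ and length $a|I|$. Put $\tilde\chi_I(x)=\bigl(1+\operatorname{dist}(x,I)/|I|\bigr)^{-10}$. A tile is a product $P=I_P\times\omega_P$ of dyadic intervals with $|I_P||\omega_P|=1$; a tri-tile is $s=(I_s\times\omega_{s_1},I_s\times\omega_{s_2},I_s\times\omega_{s_3})$, each component being a tile; and $\omega_s=\omega_{s_1}\times\omega_{s_2}$ is its frequency square. For $C\in\mathbb R$ and $N\in\mathbb N$, a $C^N$ function $\psi:\mathbb R\to\mathbb C$ is *adapted to $I$ with constant $C$ and order $N$* if $|\psi^{(k)}(x)|\le C|I|^{-k}\tilde\chi_I(x)^N$ for all $x\in\mathbb R$ and $0\le k\le N$. For $a\ge 1$, a function $\phi$ is an ($L^2$-normalized) *wave packet for $P$ with parameters $(a,C,N)$* if - $x\mapsto |I_P|^{1/2}e^{-2\pi i c(\omega_P)x}\phi(x)$ is adapted to $I_P$ with constant $C$ and order $N$; - $\xi\mapsto|\omega_P|^{1/2}e^{2\pi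 i c(I_P)\xi}\hat\phi(\xi)$ is adapted to $\omega_P$ with constant $C$ and order $N$; - $\hat\phi$ vanishes outside $a\,\omega_P$. A *model* with parameters $(B,C,N)$ consists of a (finite or infinite) collection $\Omega$ of pairwise disjoint dyadic squares with sides parallel to the axes, a finite set $\mathbb S$ of tri-tiles with $\omega_s\in\Omega$ and $|c(\omega_{s_3})-c(\omega_{s_1})-c(\omega_{s_2})|\le B|\omega_{s_1}|$ for every $s\in\mathbb S$, and, for every $s\in\mathbb S$, wave packets $\phi_{s_1},\phi_{s_2},\phi_{s_3}$ for the three tiles of $s$, with parameters $(1,C,N)$, $(1,C,N)$ and $(\tfrac{11}{10},C,N)$ respectively. With $\langle u,v\rangle=\int_{\mathbb R}u\bar v$, its trilinear form is $$\Lambda(f,g,h)=\sum_{s\in\mathbb S}|I_s|^{-1/2}\langle f,\phi_{s_1}\rangle\langle g,\phi_{s_2}\rangle\langle h_{\omega_s},\phi_{s_3}\rangle,\qquad h=\{h_\omega\}_{\omega\in\Omega}.$$ **Proposition 1.3.** Let $2<r<\infty$ and $\frac1r+\frac1{r'}=1$. There are an order $N=N(r,p,q)$ and a constant $K=K(r,p,q,B,C)$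 with the following property. Let $F,G,H\subseteq\mathbb R$ be measurable sets of finite measure with $|H|=1$. Then there is a measurable set $H'\subseteq H$ with $|H'|>|H|/2$, which depends only on $r,F,G,H$, such that $$|\Lambda(f,g,h)|\le K\,|F|^{1/p}|G|^{1/q}|H|^{1/s'},\qquad \tfrac1{s'}=1-\tfrac1s,$$ for all exponents $r'<p,q<\infty$, $\frac{r'}2<s<r$ with $\frac1p+\frac1q=\frac1s$, for the form $\Lambda$ of every model with parameters $(B,C,N(r,p,q))$, and for all measurable $f$, $g$ and $h=\{h_\omega\}_{\omega\in\Omega}$ that satisfy, almost everywhere, $$|f|\le\mathbf 1_F,\qquad |g|\le\mathbf 1_G,\qquad \Bigl(\sum_{\omega\in\Omega}|h_\omega|^{r'}\Bigr)^{1/r'}\le\mathbf 1_{H'}.$$ -/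

import Mathlib

open MeasureTheory
open scoped ENNReal FourierTransform

namespace BilinearRdF

/-- The dyadic interval `[pos * 2 ^ scale, (pos + 1) * 2 ^ scale)`. -/
structure DyadicInterval where
  scale : ℤ
  pos : ℤ

namespace DyadicInterval

/-- The length `|I|`. -/
noncomputable def length (I : DyadicInterval) : ℝ := (2 : ℝ) ^ I.scale

/-- The midpoint of `I`. -/
noncomputable def center (I : DyadicInterval) : ℝ := ((I.pos : ℝ) + 1 / 2) * I.length

/-- The interval as a set of reals. -/
def toSet (I : DyadicInterval) : Set ℝ :=
  Set.Ico ((I.pos : ℝ) * I.length) (((I.pos : ℝ) + 1) * I.length)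

/-- The closed interval with the same midpoint as `I` and length `a * |I|`. -/
def dilate (a : ℝ) (I : DyadicInterval) : Set ℝ :=
  Metric.closedBall I.center (a * I.length / 2)

/-- The weight `(1 + dist (x, I) / |I|) ^ (-10)`. -/
noncomputable def chi (I : DyadicInterval) (x : ℝ) : ℝ :=
  (1 + Metric.infDist x I.toSet / I.length) ^ (-10 : ℤ)

theorem length_pos (I : DyadicInterval) : 0 < I.length := by
  unfold length; positivity

end DyadicInterval

/-- A dyadic square with sides parallel to the axes, in the frequency plane. -/
structure DyadicSquare where
  fst : DyadicInterval
  snd : DyadicInterval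
  length_eq : fst.length = snd.length

/-- The square as a subset of the plane. -/
def DyadicSquare.toSet (w : DyadicSquare) : Set (ℝ × ℝ) := w.fst.toSet ×ˢ w.snd.toSet

/-- A time-frequency tile: a product of two dyadic intervals, of area one. -/
structure Tile where
  space : DyadicInterval
  freq : DyadicInterval
  area : space.length * freq.length = 1

/-- A tri-tile: three tiles over the same spatial interval, indexed by `0, 1, 2`. -/
structure Tritile where
  space : DyadicInterval
  freq : Fin 3 → DyadicInterval
  area : ∀ j, space.length * (freq j).length = 1

namespace Tritile

/-- The `j`-th tile of a tri-tile. -/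
def tile (s : Tritile) (j : Fin 3) : Tile := ⟨s.space, s.freq j, s.area j⟩

/-- The frequency square, the product of the first two frequency intervals. -/
def square (s : Tritile) : DyadicSquare :=
  ⟨s.freq 0, s.freq 1,
    mul_left_cancel₀ s.space.length_pos.ne' ((s.area 0).trans (s.area 1).symm)⟩

/-- The third frequency interval is comparable to the sum of the first two, with constant `B`.
Its length is that of the first two, as all tiles have area one. -/
def ThirdComparable (B : ℝ) (s : Tritile) : Prop :=
  |(s.freq 2).center - ((s.freq 0).center + (s.freq 1).center)| ≤ B * (s.freq 0).length

end Tritile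

/-- The function `x ↦ exp (2 π i θ x) φ x`. -/
noncomputable def modulate (θ : ℝ) (φ : ℝ → ℂ) (x : ℝ) : ℂ :=
  Complex.exp (2 * Real.pi * Complex.I * θ * x) * φ x

/-- `φ` is adapted to the interval `I`, with constant `C`, up to order `N`. -/
def IsAdapted (C : ℝ) (N : ℕ) (I : DyadicInterval) (φ : ℝ → ℂ) : Prop :=
  ContDiff ℝ N φ ∧
    ∀ k ≤ N, ∀ x : ℝ, ‖iteratedDeriv k φ x‖ ≤ C * (I.length ^ k)⁻¹ * I.chi x ^ N

/-- `φ` is an `L²`-normalized wave packet for the tile `P`: it is adapted to the spatial interval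
(after translating its frequency to the origin), its Fourier transform is adapted to the frequency
interval (after translating its position to the origin), and the Fourier transform is supported in
the `a`-dilate of the frequency interval. -/
def IsWavePacket (a C : ℝ) (N : ℕ) (P : Tile) (φ : ℝ → ℂ) : Prop :=
  IsAdapted C N P.space
      (fun x => (Real.sqrt P.space.length : ℂ) * modulate (-P.freq.center) φ x) ∧
    IsAdapted C N P.freq
      (fun ξ => (Real.sqrt P.freq.length : ℂ) * modulate P.space.center (𝓕 φ) ξ) ∧
    Function.support (𝓕 φ) ⊆ P.freq.dilate a

/-- The dilation factors for the frequency supports of the three packets of a tri-tile. -/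
noncomputable def dilationFactor : Fin 3 → ℝ := ![1, 1, 11 / 10]

/-- The pairing `∫ f * conj φ`. -/
noncomputable def pairing (f φ : ℝ → ℂ) : ℂ := ∫ x, f x * starRingEnd ℂ (φ x)

/-- The trilinear model form
`∑ s ∈ S, |I_s| ^ (-1/2) * ⟨f, φ s 0⟩ * ⟨g, φ s 1⟩ * ⟨h_{ω_s}, φ s 2⟩`. -/
noncomputable def modelForm (S : Finset Tritile) (φ : Tritile → Fin 3 → ℝ → ℂ)
    (f g : ℝ → ℂ) (h : DyadicSquare → ℝ → ℂ) : ℂ :=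
  ∑ s ∈ S, ((s.space.length ^ (-(1 / 2) : ℝ) : ℝ) : ℂ) *
    pairing f (φ s 0) * pairing g (φ s 1) * pairing (h s.square) (φ s 2)

/-- `S` is a finite collection of tri-tiles and `φ` a choice of wave packets, as in the model
operator for the family of frequency squares `W`. -/
structure IsModel (B C : ℝ) (N : ℕ) (W : Set DyadicSquare) (S : Finset Tritile)
    (φ : Tritile → Fin 3 → ℝ → ℂ) : Prop where
  disjoint : W.PairwiseDisjoint DyadicSquare.toSet
  square_mem : ∀ s ∈ S, s.square ∈ W
  third : ∀ s ∈ S, s.ThirdComparable B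
  packet : ∀ s ∈ S, ∀ j, IsWavePacket (dilationFactor j) C N (s.tile j) (φ s j)

end BilinearRdF

/-!
Remove from `H` the points around which `F` or `G` has density above `25 |F| / |H|`, respectively
`25 |G| / |H|`, at some scale; by the weak-type maximal bound more than half of `H` is left. If
`I_s` is `l` times its own length away from `H'`, then the density of `F` and `G` near `I_s` is
still bounded, up to a factor `O(l)`, while the coefficient of `h`, which lives on `H'`, gains
powers of `l`; so the remote tri-tiles cause no loss.

For a fixed offset of the third frequency interval, of which there are `O(B)`, tri-tiles with the
same frequency square have disjoint spatial intervals. Hölder's inequality with exponents `r` and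
`r'` therefore separates the third coefficients, which add up in `ℓ^{r'}` square by square, from the
products of the first two. For these, split according to the dyadic size of the coefficients of `f`.
In a layer, Bessel's inequality for the maximal tiles bounds the total length of the tops. Below
each top the first frequency intervals all meet, hence the second ones of distinct squares are
disjoint, and Bessel's inequality applies to `g`. The layers form a two-sided geometric series
because `r > 2`.
-/

namespace BilinearRdF

namespace DyadicInterval

variable {I J : DyadicInterval}

theorem length_eq_iff : I.length = J.length ↔ I.scale = J.scale :=
  (zpow_right_strictMono₀ (one_lt_two : (1 : ℝ) < 2)).injective.eq_iff

theorem length_le_iff : I.length ≤ J.length ↔ I.scale ≤ J.scale :=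
  (zpow_right_strictMono₀ (one_lt_two : (1 : ℝ) < 2)).le_iff_le

theorem left_lt_right (I : DyadicInterval) :
    (I.pos : ℝ) * I.length < ((I.pos : ℝ) + 1) * I.length :=
  mul_lt_mul_of_pos_right (lt_add_one _) I.length_pos

theorem length_le_of_subset (h : I.toSet ⊆ J.toSet) : I.length ≤ J.length := by
  have := (Set.Ico_subset_Ico_iff I.left_lt_right).1 h
  linarith [this.1, this.2]

theorem subset_of_not_disjoint (hl : I.length ≤ J.length) (h : ¬ Disjoint I.toSet J.toSet) :
    I.toSet ⊆ J.toSet := by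
  obtain ⟨x, hI, hJ⟩ := Set.not_disjoint_iff.1 h
  obtain ⟨k, hk⟩ := Int.le.dest (length_le_iff.1 hl)
  have hJl : J.length = 2 ^ k * I.length := by
    unfold length
    rw [← hk, zpow_add₀ two_ne_zero, zpow_natCast, mul_comm]
  have hL := I.length_pos
  simp only [toSet, Set.mem_Ico, hJl] at hI hJ
  have left_lt : I.pos < (J.pos + 1) * 2 ^ k := by
    have : (I.pos : ℝ) < ((J.pos : ℝ) + 1) * 2 ^ k :=
      lt_of_mul_lt_mul_right (by linarith [hI.1, hJ.2]) hL.le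
    exact_mod_cast this
  have lt_right : J.pos * 2 ^ k < I.pos + 1 := by
    have : (J.pos : ℝ) * 2 ^ k < (I.pos : ℝ) + 1 :=
      lt_of_mul_lt_mul_right (by linarith [hI.2, hJ.1]) hL.le
    exact_mod_cast this
  have right_le : (I.pos : ℝ) + 1 ≤ ((J.pos : ℝ) + 1) * 2 ^ k := by
    exact_mod_cast Int.add_one_le_iff.2 left_lt
  have le_left : (J.pos : ℝ) * 2 ^ k ≤ (I.pos : ℝ) := by
    exact_mod_cast Int.lt_add_one_iff.1 lt_right
  refine Set.Ico_subset_Ico ?_ ?_ <;> rw [hJl] <;> nlinarith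

theorem eq_of_not_disjoint (hl : I.length = J.length) (h : ¬ Disjoint I.toSet J.toSet) :
    I = J := by
  have hIJ := (Set.Ico_subset_Ico_iff I.left_lt_right).1 (subset_of_not_disjoint hl.le h)
  have hJI := (Set.Ico_subset_Ico_iff J.left_lt_right).1
    (subset_of_not_disjoint hl.ge fun h' => h h'.symm)
  have left_eq : (I.pos : ℝ) * I.length = J.pos * J.length := le_antisymm hJI.1 hIJ.1
  rw [hl] at left_eq
  have pos_eq : (I.pos : ℝ) = J.pos := mul_right_cancel₀ J.length_pos.ne' left_eq
  cases I; cases J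
  exact mk.injEq .. ▸ ⟨length_eq_iff.1 hl, mod_cast pos_eq⟩

theorem abs_sub_center_le {x : ℝ} (hx : x ∈ I.toSet) : |x - I.center| ≤ I.length / 2 := by
  rw [abs_le, center]
  constructor <;> linarith [hx.1, hx.2]

theorem center_mem (I : DyadicInterval) : I.center ∈ I.toSet := by
  have := I.length_pos
  constructor <;> simp only [center] <;> nlinarith

theorem dilate_one (I : DyadicInterval) :
    I.dilate 1 = Set.Icc ((I.pos : ℝ) * I.length) (((I.pos : ℝ) + 1) * I.length) := by
  rw [dilate, Real.closedBall_eq_Icc, center]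
  congr 1 <;> ring

theorem measurableSet_toSet (I : DyadicInterval) : MeasurableSet I.toSet := measurableSet_Ico

theorem volume_toSet (I : DyadicInterval) : volume I.toSet = ENNReal.ofReal I.length := by
  rw [toSet, Real.volume_Ico]
  congr 1; ring

/-- The bracket `1 + |x - c(I)| / |I|`, the smooth substitute for `1 + dist (x, I) / |I|` whose
negative powers measure the decay away from `I`. -/
noncomputable def bracket (I : DyadicInterval) (x : ℝ) : ℝ := 1 + |x - I.center| / I.length

theorem one_le_bracket (I : DyadicInterval) (x : ℝ) : 1 ≤ I.bracket x :=
  le_add_of_nonneg_right (div_nonneg (abs_nonneg _) I.length_pos.le)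

theorem bracket_pos (I : DyadicInterval) (x : ℝ) : 0 < I.bracket x :=
  zero_lt_one.trans_le (I.one_le_bracket x)

theorem continuous_bracket (I : DyadicInterval) : Continuous I.bracket := by
  unfold bracket
  fun_prop

theorem bracket_le_of_subset (h : J.toSet ⊆ I.toSet) (x : ℝ) :
    I.bracket x ≤ 2 * J.bracket x := by
  have hJ := J.length_pos
  have hI := I.length_pos
  have hl := length_le_of_subset h
  have hc := abs_sub_center_le (h J.center_mem)
  have h1 : |x - I.center| ≤ |x - J.center| + |J.center - I.center| := abs_sub_le _ _ _
  have h2 : |x - I.center| / I.length ≤ |x - J.center| / J.length + 1 := by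
    calc |x - I.center| / I.length
        ≤ (|x - J.center| + I.length) / I.length := by gcongr; linarith
      _ = |x - J.center| / I.length + 1 := by field_simp
      _ ≤ _ := by gcongr
  have : 0 ≤ |x - J.center| / J.length := by positivity
  unfold bracket
  linarith

theorem bracket_center_le (hl : J.length ≤ I.length) (x : ℝ) :
    I.bracket J.center ≤ I.bracket x * J.bracket x := by
  have hJ := J.length_pos
  have hI := I.length_pos
  have h1 : |J.center - I.center| ≤ |x - I.center| + |x - J.center| := by
    rw [abs_sub_comm x J.center, add_comm]; exact abs_sub_le _ _ _
  have h2 : |J.center - I.center| / I.length ≤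
      |x - I.center| / I.length + |x - J.center| / J.length := by
    calc |J.center - I.center| / I.length
        ≤ (|x - I.center| + |x - J.center|) / I.length := by gcongr
      _ = |x - I.center| / I.length + |x - J.center| / I.length := add_div _ _ _
      _ ≤ _ := by gcongr
  have : 0 ≤ |x - J.center| / J.length := by positivity
  have : 0 ≤ |x - I.center| / I.length := by positivity
  unfold bracket
  nlinarith

theorem bracket_le_two_mul_infDist (I : DyadicInterval) (x : ℝ) :
    I.bracket x ≤ 2 * (1 + Metric.infDist x I.toSet / I.length) := by
  have hI := I.length_pos
  have hdist : |x - I.center| - I.length / 2 ≤ Metric.infDist x I.toSet := by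
    refine (Metric.le_infDist ⟨_, I.center_mem⟩).2 fun y hy => ?_
    rw [Real.dist_eq]
    linarith [abs_sub_center_le hy, abs_sub_le x y I.center]
  have hquot : |x - I.center| / I.length ≤ 1 / 2 + Metric.infDist x I.toSet / I.length := by
    rw [div_add_div _ _ two_ne_zero hI.ne', div_le_div_iff₀ hI (by positivity)]
    nlinarith
  have : 0 ≤ Metric.infDist x I.toSet / I.length := div_nonneg Metric.infDist_nonneg hI.le
  unfold bracket
  linarith

theorem chi_le (I : DyadicInterval) (x : ℝ) : I.chi x ≤ 2 ^ 10 * (I.bracket x ^ 10)⁻¹ := by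
  have h0 := I.bracket_pos x
  have hhalf : I.bracket x / 2 ≤ 1 + Metric.infDist x I.toSet / I.length := by
    linarith [I.bracket_le_two_mul_infDist x]
  calc I.chi x = ((1 + Metric.infDist x I.toSet / I.length) ^ 10)⁻¹ := by
        rw [chi, zpow_neg]; rfl
    _ ≤ ((I.bracket x / 2) ^ 10)⁻¹ := by gcongr
    _ = _ := by rw [div_pow, inv_div, div_eq_mul_inv]

end DyadicInterval

theorem lintegral_decay_le {L : ℝ} (hL : 0 < L) (y : ℝ) :
    ∫⁻ x, ENNReal.ofReal (((1 + |x - y| / L) ^ 2)⁻¹) ≤ ENNReal.ofReal (4 * L) := by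
  have hle : ∀ x : ℝ, ENNReal.ofReal (((1 + |x - y| / L) ^ 2)⁻¹) ≤
      ENNReal.ofReal ((1 + ((x - y) / L) ^ 2)⁻¹) := by
    intro x
    have hnonneg : 0 ≤ |x - y| / L := by positivity
    have hsq : ((x - y) / L) ^ 2 = (|x - y| / L) ^ 2 := by rw [div_pow, div_pow, sq_abs]
    rw [hsq]
    gcongr
    nlinarith
  have hint : Integrable fun x : ℝ => (1 + ((x - y) / L) ^ 2)⁻¹ :=
    (integrable_inv_one_add_sq.comp_div hL.ne').comp_sub_right y
  have hval : ∫ x : ℝ, (1 + ((x - y) / L) ^ 2)⁻¹ = L * Real.pi := by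
    rw [integral_sub_right_eq_self (fun x : ℝ => (1 + (x / L) ^ 2)⁻¹) y,
      Measure.integral_comp_div (fun x : ℝ => (1 + x ^ 2)⁻¹) L, integral_univ_inv_one_add_sq,
      abs_of_pos hL, smul_eq_mul]
  refine (lintegral_mono hle).trans ?_
  rw [← ofReal_integral_eq_lintegral_ofReal hint
    (Filter.Eventually.of_forall fun x => by positivity), hval]
  exact ENNReal.ofReal_le_ofReal (by nlinarith [Real.pi_le_four])

namespace DyadicInterval

variable {J : DyadicInterval}

theorem integrable_bracket (I : DyadicInterval) : Integrable fun x => (I.bracket x ^ 2)⁻¹ := by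
  refine ⟨(Continuous.inv₀ (I.continuous_bracket.pow 2)
    fun x => (pow_pos (I.bracket_pos x) 2).ne').aestronglyMeasurable, ?_⟩
  rw [hasFiniteIntegral_iff_ofReal (Filter.Eventually.of_forall fun x => by positivity)]
  exact (lintegral_decay_le I.length_pos I.center).trans_lt ENNReal.ofReal_lt_top

theorem decay_center_le {L x : ℝ} (hL : 0 < L) (hJ : J.length ≤ L) (hx : x ∈ J.toSet) (y : ℝ) :
    ((1 + |J.center - y| / L) ^ 2)⁻¹ ≤ 4 * ((1 + |x - y| / L) ^ 2)⁻¹ := by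
  have hquot : |x - y| / L ≤ 1 + |J.center - y| / L := by
    calc |x - y| / L ≤ (L + |J.center - y|) / L := by
          gcongr
          linarith [abs_sub_center_le hx, abs_sub_le x J.center y, J.length_pos]
      _ = _ := by field_simp
  have h1 : 0 ≤ |J.center - y| / L := by positivity
  have hhalf : (1 + |x - y| / L) / 2 ≤ 1 + |J.center - y| / L := by linarith
  calc ((1 + |J.center - y| / L) ^ 2)⁻¹ ≤ (((1 + |x - y| / L) / 2) ^ 2)⁻¹ := by gcongr
    _ = _ := by rw [div_pow, inv_div, div_eq_mul_inv]; norm_num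

theorem length_mul_decay_le_setLIntegral {L : ℝ} (hL : 0 < L) (hJ : J.length ≤ L) (y : ℝ) :
    ENNReal.ofReal (J.length * ((1 + |J.center - y| / L) ^ 2)⁻¹) ≤
      ∫⁻ x in J.toSet, 4 * ENNReal.ofReal (((1 + |x - y| / L) ^ 2)⁻¹) := by
  calc ENNReal.ofReal (J.length * ((1 + |J.center - y| / L) ^ 2)⁻¹)
      = ∫⁻ _ in J.toSet, ENNReal.ofReal (((1 + |J.center - y| / L) ^ 2)⁻¹) := by
        rw [setLIntegral_const, J.volume_toSet, mul_comm, ENNReal.ofReal_mul (by positivity)]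
    _ ≤ _ := by
        refine setLIntegral_mono' J.measurableSet_toSet fun x hx => ?_
        rw [show (4 : ℝ≥0∞) = ENNReal.ofReal 4 by norm_num, ← ENNReal.ofReal_mul (by norm_num)]
        exact ENNReal.ofReal_le_ofReal (decay_center_le hL hJ hx y)

end DyadicInterval

theorem sum_length_mul_decay_le {ι : Type*} (s : Finset ι) (J : ι → DyadicInterval) {L : ℝ}
    (hL : 0 < L) (hJ : ∀ i ∈ s, (J i).length ≤ L)
    (hd : (s : Set ι).PairwiseDisjoint fun i => (J i).toSet) (y : ℝ) :
    ∑ i ∈ s, (J i).length * ((1 + |(J i).center - y| / L) ^ 2)⁻¹ ≤ 16 * L := by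
  refine (ENNReal.ofReal_le_ofReal_iff (by positivity)).1 ?_
  rw [ENNReal.ofReal_sum_of_nonneg fun i _ => mul_nonneg (J i).length_pos.le (by positivity)]
  calc ∑ i ∈ s, ENNReal.ofReal ((J i).length * ((1 + |(J i).center - y| / L) ^ 2)⁻¹)
      ≤ ∑ i ∈ s, ∫⁻ x in (J i).toSet, 4 * ENNReal.ofReal (((1 + |x - y| / L) ^ 2)⁻¹) :=
        Finset.sum_le_sum fun i hi =>
          DyadicInterval.length_mul_decay_le_setLIntegral hL (hJ i hi) y
    _ = ∫⁻ x in ⋃ i ∈ s, (J i).toSet, 4 * ENNReal.ofReal (((1 + |x - y| / L) ^ 2)⁻¹) :=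
        (lintegral_biUnion_finset hd (fun i _ => (J i).measurableSet_toSet) _).symm
    _ ≤ 4 * ∫⁻ x, ENNReal.ofReal (((1 + |x - y| / L) ^ 2)⁻¹) := by
        rw [← lintegral_const_mul' _ _ (by norm_num)]
        exact setLIntegral_le_lintegral _ _
    _ ≤ 4 * ENNReal.ofReal (4 * L) := by gcongr; exact lintegral_decay_le hL y
    _ = ENNReal.ofReal (16 * L) := by
        rw [show (4 : ℝ≥0∞) = ENNReal.ofReal 4 by norm_num, ← ENNReal.ofReal_mul (by norm_num)]
        congr 1; ring

theorem norm_pairing_comm (f φ : ℝ → ℂ) : ‖pairing f φ‖ = ‖pairing φ f‖ := by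
  rw [← RCLike.norm_conj (pairing f φ), pairing, ← integral_conj, pairing]
  simp only [map_mul, Complex.conj_conj, mul_comm]

theorem norm_pairing_le {I : DyadicInterval} {f φ : ℝ → ℂ} {c : ℝ} (hc : 0 ≤ c)
    (h : ∀ᵐ x, ‖f x‖ * ‖φ x‖ ≤ c * (I.bracket x ^ 2)⁻¹) : ‖pairing f φ‖ ≤ 4 * c * I.length := by
  have hI := I.length_pos
  have mass_le : ∫ x, (I.bracket x ^ 2)⁻¹ ≤ 4 * I.length := by
    rw [integral_eq_lintegral_of_nonneg_ae (Filter.Eventually.of_forall fun x => by positivity)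
      I.integrable_bracket.aestronglyMeasurable]
    exact ENNReal.toReal_le_of_le_ofReal (by positivity) (lintegral_decay_le hI I.center)
  calc ‖pairing f φ‖ ≤ ∫ x, c * (I.bracket x ^ 2)⁻¹ :=
        norm_integral_le_of_norm_le (I.integrable_bracket.const_mul c) <| by
          simpa only [norm_mul, RCLike.norm_conj] using h
    _ = c * ∫ x, (I.bracket x ^ 2)⁻¹ := integral_const_mul _ _
    _ ≤ c * (4 * I.length) := by gcongr
    _ = 4 * c * I.length := by ring

/-- A bump over `I`: a continuous function which is `L²`-normalized at the scale of `I`, with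
constant `D`, and decays like the `m`-th power of the relative distance from `I`. -/
structure IsBump (m : ℕ) (D : ℝ) (I : DyadicInterval) (v : ℝ → ℂ) : Prop where
  continuous : Continuous v
  bound : ∀ x, ‖v x‖ ≤ D * (√I.length)⁻¹ * (I.bracket x ^ m)⁻¹

namespace IsBump

variable {m n : ℕ} {D : ℝ} {I J : DyadicInterval} {u v : ℝ → ℂ}

theorem nonneg (hv : IsBump m D I v) : 0 ≤ D := by
  have hpos : 0 < (√I.length)⁻¹ * (I.bracket 0 ^ m)⁻¹ :=
    mul_pos (inv_pos.2 (Real.sqrt_pos.2 I.length_pos)) (inv_pos.2 (pow_pos (I.bracket_pos 0) m))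
  have hbound := (norm_nonneg _).trans (hv.bound 0)
  rw [mul_assoc] at hbound
  exact nonneg_of_mul_nonneg_left hbound hpos

theorem mono (hv : IsBump n D I v) (hmn : m ≤ n) : IsBump m D I v where
  continuous := hv.continuous
  bound x := by
    refine (hv.bound x).trans ?_
    have := hv.nonneg
    have := I.one_le_bracket x
    gcongr

theorem integrable (hv : IsBump 2 D I v) : Integrable v :=
  (I.integrable_bracket.const_mul _).mono' hv.continuous.aestronglyMeasurable
    (Filter.Eventually.of_forall hv.bound)

theorem memLp (hv : IsBump 1 D I v) : MemLp v 2 := by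
  rw [memLp_two_iff_integrable_sq_norm hv.continuous.aestronglyMeasurable]
  refine (I.integrable_bracket.const_mul ((D * (√I.length)⁻¹) ^ 2)).mono'
    (hv.continuous.norm.pow 2).aestronglyMeasurable (Filter.Eventually.of_forall fun x => ?_)
  have := hv.nonneg
  rw [Real.norm_of_nonneg (by positivity)]
  calc ‖v x‖ ^ 2 ≤ (D * (√I.length)⁻¹ * (I.bracket x ^ 1)⁻¹) ^ 2 := by
        gcongr; exact hv.bound x
    _ = _ := by rw [pow_one, mul_pow, inv_pow (I.bracket x)]

theorem inv_bracket_mul_le (hl : J.length ≤ I.length) (x : ℝ) :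
    (I.bracket x ^ 4)⁻¹ * (J.bracket x ^ 4)⁻¹ ≤
      (I.bracket J.center ^ 2)⁻¹ * (J.bracket x ^ 2)⁻¹ := by
  have := I.bracket_pos x
  have := J.bracket_pos x
  have := I.bracket_pos J.center
  have := I.one_le_bracket x
  rw [← mul_inv, ← mul_inv]
  refine inv_anti₀ (by positivity) ?_
  calc I.bracket J.center ^ 2 * J.bracket x ^ 2
      ≤ (I.bracket x * J.bracket x) ^ 2 * J.bracket x ^ 2 := by
        gcongr
        exact DyadicInterval.bracket_center_le hl x
    _ = I.bracket x ^ 2 * J.bracket x ^ 4 := by ring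
    _ ≤ I.bracket x ^ 4 * J.bracket x ^ 4 := by gcongr; norm_num

theorem norm_pairing_le (hu : IsBump 4 D I u) (hv : IsBump 4 D J v) (hl : J.length ≤ I.length) :
    ‖pairing u v‖ ≤ 4 * D ^ 2 * (√J.length / √I.length) * (I.bracket J.center ^ 2)⁻¹ := by
  have hD := hu.nonneg
  have hb := I.bracket_pos J.center
  have pointwise (x : ℝ) : ‖u x‖ * ‖v x‖ ≤
      D ^ 2 * ((√I.length)⁻¹ * (√J.length)⁻¹) * (I.bracket J.center ^ 2)⁻¹ *
        (J.bracket x ^ 2)⁻¹ := by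
    have := I.bracket_pos x
    have := J.bracket_pos x
    calc ‖u x‖ * ‖v x‖ ≤ (D * (√I.length)⁻¹ * (I.bracket x ^ 4)⁻¹) *
          (D * (√J.length)⁻¹ * (J.bracket x ^ 4)⁻¹) :=
          mul_le_mul (hu.bound x) (hv.bound x) (norm_nonneg _) (by positivity)
      _ = D ^ 2 * ((√I.length)⁻¹ * (√J.length)⁻¹) *
          ((I.bracket x ^ 4)⁻¹ * (J.bracket x ^ 4)⁻¹) := by ring
      _ ≤ D ^ 2 * ((√I.length)⁻¹ * (√J.length)⁻¹) *
          ((I.bracket J.center ^ 2)⁻¹ * (J.bracket x ^ 2)⁻¹) := by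
          gcongr ?_ * ?_
          exact inv_bracket_mul_le hl x
      _ = _ := by ring
  calc ‖pairing u v‖
      ≤ 4 * (D ^ 2 * ((√I.length)⁻¹ * (√J.length)⁻¹) * (I.bracket J.center ^ 2)⁻¹) * J.length :=
        BilinearRdF.norm_pairing_le (by positivity) (Filter.Eventually.of_forall pointwise)
    _ = 4 * D ^ 2 * (J.length / √J.length / √I.length) * (I.bracket J.center ^ 2)⁻¹ := by ring
    _ = _ := by rw [Real.div_sqrt]

end IsBump

/-- The weight with which Schur's test is applied to the Gram matrix of a family of bumps: twice
the size of the inner product of bumps over `I` and over a shorter interval `J`, times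
`(|J| / |I|) ^ (1/2)`. -/
noncomputable def schurWeight (D : ℝ) (I J : DyadicInterval) : ℝ :=
  8 * D ^ 2 * (J.length / I.length) * (I.bracket J.center ^ 2)⁻¹

theorem schurWeight_nonneg (D : ℝ) (I J : DyadicInterval) : 0 ≤ schurWeight D I J := by
  have := I.length_pos
  have := J.length_pos
  unfold schurWeight
  positivity

theorem schurWeight_comm (D : ℝ) {I J : DyadicInterval} (hl : J.length = I.length) :
    schurWeight D J I = schurWeight D I J := by
  simp only [schurWeight, DyadicInterval.bracket, hl, abs_sub_comm]

theorem sum_schurWeight_le {ι : Type*} (s : Finset ι) (D : ℝ) (I : DyadicInterval)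
    (J : ι → DyadicInterval) (hJ : ∀ j ∈ s, (J j).length ≤ I.length)
    (hd : (s : Set ι).PairwiseDisjoint fun j => (J j).toSet) :
    ∑ j ∈ s, schurWeight D I (J j) ≤ 128 * D ^ 2 := by
  have hI := I.length_pos
  calc ∑ j ∈ s, schurWeight D I (J j)
      = 8 * D ^ 2 / I.length *
          ∑ j ∈ s, (J j).length * ((1 + |(J j).center - I.center| / I.length) ^ 2)⁻¹ := by
        rw [Finset.mul_sum]
        refine Finset.sum_congr rfl fun j _ => ?_
        rw [schurWeight, DyadicInterval.bracket]; ring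
    _ ≤ 8 * D ^ 2 / I.length * (16 * I.length) := by
        gcongr
        exact sum_length_mul_decay_le s J hI hJ hd I.center
    _ = _ := by field_simp; ring

namespace IsBump

variable {D a b : ℝ} {I J : DyadicInterval} {u v : ℝ → ℂ}

theorem mul_norm_pairing_le (hu : IsBump 4 D I u) (hv : IsBump 4 D J v)
    (hl : J.length ≤ I.length) (ha : 0 ≤ a) (hab : b * √I.length ≤ 2 * a * √J.length) :
    a * b * ‖pairing u v‖ ≤ a ^ 2 * schurWeight D I J := by
  have hI := Real.sqrt_pos.2 I.length_pos
  have := I.bracket_pos J.center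
  have hb' : b ≤ 2 * a * (√J.length / √I.length) := by
    rwa [← mul_div_assoc, le_div_iff₀ hI]
  calc a * b * ‖pairing u v‖ ≤ a * (2 * a * (√J.length / √I.length)) *
        (4 * D ^ 2 * (√J.length / √I.length) * (I.bracket J.center ^ 2)⁻¹) := by
        gcongr
        exact hu.norm_pairing_le hv hl
    _ = a ^ 2 * (8 * D ^ 2 * (√J.length / √I.length) ^ 2 * (I.bracket J.center ^ 2)⁻¹) := by ring
    _ = a ^ 2 * schurWeight D I J := by
        rw [div_pow, Real.sq_sqrt I.length_pos.le, Real.sq_sqrt J.length_pos.le, schurWeight]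

theorem mul_norm_pairing_le_of_length_eq (hu : IsBump 4 D I u) (hv : IsBump 4 D J v)
    (hl : J.length = I.length) (ha : 0 ≤ a) (hb : 0 ≤ b) :
    a * b * ‖pairing u v‖ ≤ a ^ 2 * schurWeight D I J + b ^ 2 * schurWeight D J I := by
  rw [schurWeight_comm D hl]
  have hw := schurWeight_nonneg D I J
  rcases le_total a b with hab | hab
  · calc a * b * ‖pairing u v‖ = b * a * ‖pairing v u‖ := by
          rw [mul_comm a, norm_pairing_comm]
      _ ≤ b ^ 2 * schurWeight D J I :=
          hv.mul_norm_pairing_le hu hl.ge hb (by rw [hl]; gcongr; linarith)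
      _ = b ^ 2 * schurWeight D I J := by rw [schurWeight_comm D hl]
      _ ≤ _ := le_add_of_nonneg_left (by positivity)
  · calc a * b * ‖pairing u v‖ ≤ a ^ 2 * schurWeight D I J :=
          hu.mul_norm_pairing_le hv hl.le ha (by rw [hl]; gcongr; linarith)
      _ ≤ _ := le_add_of_nonneg_right (by positivity)

end IsBump

theorem norm_sum_smul_sq_le {E ι : Type*} [NormedAddCommGroup E] [InnerProductSpace ℂ E]
    (s : Finset ι) (v : ι → E) (c : ι → ℂ) (n : ι → ι → ℝ) {D : ℝ}
    (h : ∀ i ∈ s, ∀ j ∈ s, ‖c i‖ * ‖c j‖ * ‖inner ℂ (v i) (v j)‖ ≤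
      ‖c i‖ ^ 2 * n i j + ‖c j‖ ^ 2 * n j i)
    (hn : ∀ i ∈ s, ∑ j ∈ s, n i j ≤ D) :
    ‖∑ i ∈ s, c i • v i‖ ^ 2 ≤ 2 * D * ∑ i ∈ s, ‖c i‖ ^ 2 := by
  have expand : ‖∑ i ∈ s, c i • v i‖ ^ 2 ≤
      ∑ i ∈ s, ∑ j ∈ s, ‖c i‖ * ‖c j‖ * ‖inner ℂ (v i) (v j)‖ := by
    calc ‖∑ i ∈ s, c i • v i‖ ^ 2 = ‖inner ℂ (∑ i ∈ s, c i • v i) (∑ j ∈ s, c j • v j)‖ := by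
          rw [inner_self_eq_norm_sq_to_K]
          simp only [norm_pow, RCLike.norm_ofReal, abs_norm]
      _ = ‖∑ i ∈ s, ∑ j ∈ s, inner ℂ (c i • v i) (c j • v j)‖ := by
          rw [sum_inner]
          simp only [inner_sum]
      _ ≤ _ := (norm_sum_le _ _).trans (Finset.sum_le_sum fun i _ => norm_sum_le _ _)
      _ = _ := by
          refine Finset.sum_congr rfl fun i _ => Finset.sum_congr rfl fun j _ => ?_
          rw [inner_smul_left, inner_smul_right, norm_mul, norm_mul, RCLike.norm_conj, mul_assoc]
  have row_le : ∑ i ∈ s, ∑ j ∈ s, ‖c i‖ ^ 2 * n i j ≤ D * ∑ i ∈ s, ‖c i‖ ^ 2 := by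
    rw [Finset.mul_sum]
    refine Finset.sum_le_sum fun i hi => ?_
    rw [← Finset.mul_sum, mul_comm D]
    exact mul_le_mul_of_nonneg_left (hn i hi) (by positivity)
  calc ‖∑ i ∈ s, c i • v i‖ ^ 2
      ≤ ∑ i ∈ s, ∑ j ∈ s, (‖c i‖ ^ 2 * n i j + ‖c j‖ ^ 2 * n j i) :=
        expand.trans (Finset.sum_le_sum fun i hi => Finset.sum_le_sum fun j hj => h i hi j hj)
    _ = 2 * ∑ i ∈ s, ∑ j ∈ s, ‖c i‖ ^ 2 * n i j := by
        simp only [Finset.sum_add_distrib]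
        rw [Finset.sum_comm (f := fun i j => ‖c j‖ ^ 2 * n j i), two_mul]
    _ ≤ 2 * D * ∑ i ∈ s, ‖c i‖ ^ 2 := by linarith

theorem sum_norm_inner_sq_le {E ι : Type*} [NormedAddCommGroup E] [InnerProductSpace ℂ E]
    (s : Finset ι) (v : ι → E) (f : E) {M : ℝ} (hM : 0 ≤ M)
    (h : ‖∑ i ∈ s, inner ℂ (v i) f • v i‖ ^ 2 ≤ M * ∑ i ∈ s, ‖inner ℂ (v i) f‖ ^ 2) :
    ∑ i ∈ s, ‖inner ℂ (v i) f‖ ^ 2 ≤ M * ‖f‖ ^ 2 := by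
  set X := ∑ i ∈ s, ‖inner ℂ (v i) f‖ ^ 2 with hX
  set u := ∑ i ∈ s, inner ℂ (v i) f • v i with hu
  have hX0 : 0 ≤ X := Finset.sum_nonneg fun i _ => by positivity
  have inner_eq : inner ℂ u f = (X : ℂ) := by
    rw [hu, sum_inner, hX]
    push_cast
    refine Finset.sum_congr rfl fun i _ => ?_
    rw [inner_smul_left, Complex.conj_mul']
  have cauchy_schwarz : X ≤ ‖u‖ * ‖f‖ := by
    have := norm_inner_le_norm (𝕜 := ℂ) u f
    rwa [inner_eq, Complex.norm_real, Real.norm_of_nonneg hX0] at this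
  rcases hX0.eq_or_lt with h0 | h0
  · rw [← h0]; positivity
  · refine le_of_mul_le_mul_right ?_ h0
    calc X * X ≤ (‖u‖ * ‖f‖) * (‖u‖ * ‖f‖) := mul_self_le_mul_self hX0 cauchy_schwarz
      _ = ‖u‖ ^ 2 * ‖f‖ ^ 2 := by ring
      _ ≤ M * X * ‖f‖ ^ 2 := by gcongr
      _ = _ := by ring

theorem inner_toLp_eq_pairing {f v : ℝ → ℂ} (hv : MemLp v 2) (hf : MemLp f 2) :
    inner ℂ (hv.toLp v) (hf.toLp f) = pairing f v := by
  rw [L2.inner_def, pairing]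
  refine integral_congr_ae ?_
  filter_upwards [hv.coeFn_toLp, hf.coeFn_toLp] with x h1 h2
  rw [h1, h2, RCLike.inner_apply]

theorem norm_toLp_sq {f : ℝ → ℂ} (hf : MemLp f 2) :
    ‖hf.toLp f‖ ^ 2 = ∫ x, ‖f x‖ ^ 2 := by
  have h := inner_self_eq_norm_sq_to_K (𝕜 := ℂ) (hf.toLp f)
  have hpt (x : ℝ) : f x * starRingEnd ℂ (f x) = ((‖f x‖ ^ 2 : ℝ) : ℂ) := by
    rw [Complex.mul_conj', Complex.ofReal_pow]
  simp only [inner_toLp_eq_pairing hf hf, pairing, hpt, integral_complex_ofReal] at h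
  exact (Complex.ofReal_injective (h.trans (by norm_cast))).symm

theorem sum_norm_pairing_sq_le_of_schur {ι : Type*} (s : Finset ι) (v : ι → ℝ → ℂ)
    (hv : ∀ i ∈ s, MemLp (v i) 2) {f : ℝ → ℂ} (hf : MemLp f 2) (n : ι → ι → ℝ) {D : ℝ}
    (hD : 0 ≤ D)
    (h : ∀ i ∈ s, ∀ j ∈ s, ‖pairing f (v i)‖ * ‖pairing f (v j)‖ * ‖pairing (v i) (v j)‖ ≤
      ‖pairing f (v i)‖ ^ 2 * n i j + ‖pairing f (v j)‖ ^ 2 * n j i)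
    (hn : ∀ i ∈ s, ∑ j ∈ s, n i j ≤ D) :
    ∑ i ∈ s, ‖pairing f (v i)‖ ^ 2 ≤ 2 * D * ∫ x, ‖f x‖ ^ 2 := by
  classical
  let V : ι → Lp ℂ 2 (volume : Measure ℝ) := fun i =>
    if h : MemLp (v i) 2 then h.toLp (v i) else 0
  have hV : ∀ i (hi : i ∈ s), V i = (hv i hi).toLp (v i) := fun i hi => dif_pos _
  have inner_f : ∀ i ∈ s, inner ℂ (V i) (hf.toLp f) = pairing f (v i) := fun i hi => by
    rw [hV i hi, inner_toLp_eq_pairing]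
  have inner_V : ∀ i ∈ s, ∀ j ∈ s, ‖inner ℂ (V i) (V j)‖ = ‖pairing (v i) (v j)‖ :=
    fun i hi j hj => by rw [hV i hi, hV j hj, inner_toLp_eq_pairing, norm_pairing_comm]
  have bessel := sum_norm_inner_sq_le s V (hf.toLp f) (by positivity : 0 ≤ 2 * D)
    (norm_sum_smul_sq_le s V _ n (fun i hi j hj => by
      rw [inner_f i hi, inner_f j hj, inner_V i hi j hj]
      exact h i hi j hj) hn)
  rw [norm_toLp_sq] at bessel
  exact (Finset.sum_congr rfl fun i hi => by rw [inner_f i hi]).trans_le bessel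

theorem sum_norm_pairing_sq_le {ι : Type*} (s : Finset ι) (I : ι → DyadicInterval)
    (v : ι → ℝ → ℂ) {D : ℝ} (hv : ∀ i ∈ s, IsBump 4 D (I i) (v i)) {f : ℝ → ℂ}
    (hf : MemLp f 2)
    (hd : ∀ i ∈ s,
      {j | j ∈ s ∧ (I j).length ≤ (I i).length ∧ pairing (v j) (v i) ≠ 0}.PairwiseDisjoint
        fun j => (I j).toSet)
    (hc : ∀ i ∈ s, ∀ j ∈ s, (I j).length ≤ (I i).length → pairing (v j) (v i) ≠ 0 →
      (I j).length = (I i).length ∨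
        ‖pairing f (v j)‖ * √(I i).length ≤ 2 * ‖pairing f (v i)‖ * √(I j).length) :
    ∑ i ∈ s, ‖pairing f (v i)‖ ^ 2 ≤ 256 * D ^ 2 * ∫ x, ‖f x‖ ^ 2 := by
  classical
  let n : ι → ι → ℝ := fun i j =>
    if (I j).length ≤ (I i).length ∧ pairing (v j) (v i) ≠ 0 then schurWeight D (I i) (I j) else 0
  have n_nonneg (i j : ι) : 0 ≤ n i j := by
    simp only [n]
    split_ifs
    exacts [schurWeight_nonneg .., le_rfl]
  have sum_n_le : ∀ i ∈ s, ∑ j ∈ s, n i j ≤ 128 * D ^ 2 := fun i hi => by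
    simp only [n, ← Finset.sum_filter]
    refine sum_schurWeight_le _ D (I i) I (fun j hj => (Finset.mem_filter.1 hj).2.1) ?_
    simpa only [Finset.coe_filter] using hd i hi
  have gram_le : ∀ i ∈ s, ∀ j ∈ s,
      ‖pairing f (v i)‖ * ‖pairing f (v j)‖ * ‖pairing (v i) (v j)‖ ≤
        ‖pairing f (v i)‖ ^ 2 * n i j + ‖pairing f (v j)‖ ^ 2 * n j i := by
    intro i hi j hj
    wlog hl : (I j).length ≤ (I i).length generalizing i j
    · have := this j hj i hi (le_of_not_ge hl)
      rwa [mul_comm ‖pairing f (v j)‖, norm_pairing_comm (v j), add_comm] at this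
    have hswap := norm_pairing_comm (v i) (v j)
    by_cases h0 : pairing (v j) (v i) = 0
    · rw [hswap, h0, norm_zero, mul_zero]
      have := n_nonneg i j
      have := n_nonneg j i
      positivity
    have hij : n i j = schurWeight D (I i) (I j) := if_pos ⟨hl, h0⟩
    rcases hc i hi j hj hl h0 with he | he
    · have hji : n j i = schurWeight D (I j) (I i) :=
        if_pos ⟨he.ge, norm_ne_zero_iff.1 (hswap ▸ norm_ne_zero_iff.2 h0)⟩
      rw [hij, hji]
      exact (hv i hi).mul_norm_pairing_le_of_length_eq (hv j hj) he (norm_nonneg _) (norm_nonneg _)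
    · rw [hij]
      exact le_add_of_le_of_nonneg ((hv i hi).mul_norm_pairing_le (hv j hj) hl (norm_nonneg _) he)
        (mul_nonneg (by positivity) (n_nonneg j i))
  refine (sum_norm_pairing_sq_le_of_schur s v (fun i hi => ((hv i hi).mono (by norm_num)).memLp) hf
    n (by positivity) gram_le sum_n_le).trans_eq (by ring)

theorem support_fourier_smul_subset {φ : ℝ → ℂ} (hφ : Integrable φ)
    (hxφ : Integrable fun x : ℝ => x • φ x) {K : Set ℝ} (hK : IsClosed K)
    (h : Function.support (𝓕 φ) ⊆ K) : Function.support (𝓕 fun x : ℝ => x • φ x) ⊆ K := by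
  intro ξ hξ
  by_contra hn
  have hev : 𝓕 φ =ᶠ[nhds ξ] fun _ => 0 := by
    filter_upwards [hK.isOpen_compl.mem_nhds hn] with η hη
    exact Function.notMem_support.1 fun h0 => hη (h h0)
  have hderiv : 𝓕 (fun x : ℝ => (-2 * Real.pi * Complex.I * x) • φ x) ξ = 0 :=
    (Real.hasDerivAt_fourier hφ hxφ ξ).unique
      ((hasDerivAt_const ξ (0 : ℂ)).congr_of_eventuallyEq hev)
  have hsmul : 𝓕 (fun x : ℝ => (-2 * Real.pi * Complex.I * x) • φ x) =
      (-2 * Real.pi * Complex.I) • 𝓕 fun x : ℝ => x • φ x := by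
    refine Eq.trans (congrArg _ ?_) (VectorFourier.fourierIntegral_const_smul ..)
    funext x
    simp only [Pi.smul_apply, Complex.real_smul, smul_eq_mul, mul_assoc]
  rw [hsmul, Pi.smul_apply, smul_eq_zero] at hderiv
  exact hξ (hderiv.resolve_left (by simp [Real.pi_ne_zero]))

theorem integrable_fourier_of_support {u : ℝ → ℂ} (hu : Integrable u) {K : Set ℝ}
    (hK : IsCompact K) (h : Function.support (𝓕 u) ⊆ K) : Integrable (𝓕 u) :=
  have continuous_fourier : Continuous (𝓕 u) :=
    VectorFourier.fourierIntegral_continuous Real.continuous_fourierChar continuous_inner hu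
  continuous_fourier.integrable_of_hasCompactSupport (.of_support_subset_isCompact hK h)

theorem pairing_eq_integral_fourier {u v : ℝ → ℂ} (hu : Continuous u) (hui : Integrable u)
    (hvi : Integrable v) (hFu : Integrable (𝓕 u)) :
    pairing u v = ∫ ξ, inner ℂ (𝓕 v ξ) (𝓕 u ξ) := by
  have key := VectorFourier.integral_sesq_fourierIntegral_eq_neg_flip (innerSL ℂ (E := ℂ))
    (L := innerₗ ℝ) (f := v) (g := 𝓕 u) (μ := volume) (ν := volume)
    Real.continuous_fourierChar continuous_inner hvi hFu
  have key' : ∫ ξ, inner ℂ (𝓕 v ξ) (𝓕 u ξ) = ∫ x, inner ℂ (v x) (𝓕⁻ (𝓕 u) x) := by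
    simpa using! key
  rw [key', hu.fourierInv_fourier_eq hui hFu]
  simp only [pairing, RCLike.inner_apply]

theorem DyadicInterval.toSet_ae_eq_dilate_one (I : DyadicInterval) :
    I.toSet =ᵐ[volume] I.dilate 1 := by
  rw [I.dilate_one]
  exact Ico_ae_eq_Icc

theorem pairing_eq_zero_of_disjoint {u v : ℝ → ℂ} (hu : Continuous u) (hui : Integrable u)
    (hvi : Integrable v) {ω ω' : DyadicInterval}
    (h : Function.support (𝓕 u) ⊆ ω.dilate 1) (h' : Function.support (𝓕 v) ⊆ ω'.dilate 1)
    (hd : Disjoint ω.toSet ω'.toSet) : pairing u v = 0 := by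
  rw [pairing_eq_integral_fourier hu hui hvi
    (integrable_fourier_of_support hui (isCompact_closedBall _ _) h)]
  refine integral_eq_zero_of_ae ?_
  filter_upwards [ω.toSet_ae_eq_dilate_one.mem_iff, ω'.toSet_ae_eq_dilate_one.mem_iff]
    with ξ hω hω'
  by_contra hne
  have hv0 : 𝓕 v ξ ≠ 0 := fun h0 => hne (by rw [h0, inner_zero_left]; rfl)
  have hu0 : 𝓕 u ξ ≠ 0 := fun h0 => hne (by rw [h0, inner_zero_right]; rfl)
  exact Set.disjoint_left.1 hd (hω.2 (h hu0)) (hω'.2 (h' hv0))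

/-- The function `1 + i (x - c(J)) / |J|`. It is comparable to the bracket of `J`, and multiplying
by it does not enlarge frequency supports, since it is a polynomial. -/
noncomputable def affineWeight (J : DyadicInterval) (x : ℝ) : ℂ :=
  1 + ((x - J.center) / J.length : ℝ) * Complex.I

section affineWeight

variable (J : DyadicInterval)

theorem norm_sq_affineWeight (x : ℝ) :
    ‖affineWeight J x‖ ^ 2 = 1 + (|x - J.center| / J.length) ^ 2 := by
  rw [← Complex.normSq_eq_norm_sq, affineWeight, ← Complex.ofReal_one, Complex.normSq_add_mul_I,
    one_pow, div_pow, div_pow, sq_abs]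

theorem norm_affineWeight_le (x : ℝ) : ‖affineWeight J x‖ ≤ J.bracket x := by
  refine le_of_sq_le_sq ?_ (J.bracket_pos x).le
  have : 0 ≤ |x - J.center| / J.length := div_nonneg (abs_nonneg _) J.length_pos.le
  rw [norm_sq_affineWeight, DyadicInterval.bracket]
  nlinarith

theorem one_le_norm_affineWeight (x : ℝ) : 1 ≤ ‖affineWeight J x‖ := by
  rw [← one_le_sq_iff₀ (norm_nonneg _), norm_sq_affineWeight]
  exact le_add_of_nonneg_right (sq_nonneg _)

theorem affineWeight_ne_zero (x : ℝ) : affineWeight J x ≠ 0 :=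
  norm_pos_iff.1 (zero_lt_one.trans_le (one_le_norm_affineWeight J x))

theorem inv_norm_sq_affineWeight_le (x : ℝ) :
    (‖affineWeight J x‖ ^ 2)⁻¹ ≤ 2 * (J.bracket x ^ 2)⁻¹ := by
  have := J.bracket_pos x
  rw [← div_eq_mul_inv, inv_le_comm₀ (pow_pos (norm_pos_iff.2 (affineWeight_ne_zero J x)) 2)
    (by positivity), inv_div, norm_sq_affineWeight, DyadicInterval.bracket,
    div_le_iff₀ two_pos]
  nlinarith [sq_nonneg (|x - J.center| / J.length - 1)]

theorem continuous_affineWeight : Continuous (affineWeight J) := by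
  unfold affineWeight
  fun_prop

theorem pairing_eq_pairing_affineWeight_mul (g φ : ℝ → ℂ) :
    pairing g φ = pairing (fun x => (starRingEnd ℂ (affineWeight J x))⁻¹ * g x)
      (fun x => affineWeight J x * φ x) := by
  refine integral_congr_ae (Filter.Eventually.of_forall fun x => ?_)
  have := (map_ne_zero (starRingEnd ℂ)).2 (affineWeight_ne_zero J x)
  simp only [map_mul]
  field_simp

theorem norm_inv_affineWeight_mul_le (g : ℝ → ℂ) (x : ℝ) :
    ‖(starRingEnd ℂ (affineWeight J x))⁻¹ * g x‖ ≤ ‖g x‖ := by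
  rw [norm_mul, norm_inv, RCLike.norm_conj]
  exact mul_le_of_le_one_left (norm_nonneg _) (inv_le_one_of_one_le₀ (one_le_norm_affineWeight J x))

variable {J} {g : ℝ → ℂ}

theorem memLp_inv_affineWeight_mul (hg : MemLp g 2) :
    MemLp (fun x => (starRingEnd ℂ (affineWeight J x))⁻¹ * g x) 2 := by
  have hcont : Continuous fun x => (starRingEnd ℂ (affineWeight J x))⁻¹ :=
    Continuous.inv₀ (Complex.continuous_conj.comp (continuous_affineWeight J))
      fun x => (map_ne_zero _).2 (affineWeight_ne_zero J x)
  exact hg.of_le (hcont.aestronglyMeasurable.mul hg.1)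
    (Filter.Eventually.of_forall (norm_inv_affineWeight_mul_le J g))

theorem integral_sq_inv_affineWeight_mul_le (hg : MemLp g 2) :
    ∫ x, ‖(starRingEnd ℂ (affineWeight J x))⁻¹ * g x‖ ^ 2 ≤
      2 * ∫ x, ‖g x‖ ^ 2 * (J.bracket x ^ 2)⁻¹ := by
  have weighted_integrable : Integrable fun x => ‖g x‖ ^ 2 * (J.bracket x ^ 2)⁻¹ := by
    refine (hg.integrable_norm_pow two_ne_zero).mono' ((hg.1.norm.pow 2).mul
      J.integrable_bracket.aestronglyMeasurable) (Filter.Eventually.of_forall fun x => ?_)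
    rw [Real.norm_of_nonneg (by positivity)]
    exact mul_le_of_le_one_right (by positivity)
      (inv_le_one_of_one_le₀ (one_le_pow₀ (J.one_le_bracket x)))
  rw [← integral_const_mul]
  refine integral_mono ((memLp_inv_affineWeight_mul hg).integrable_norm_pow two_ne_zero)
    (weighted_integrable.const_mul 2) fun x => ?_
  calc ‖(starRingEnd ℂ (affineWeight J x))⁻¹ * g x‖ ^ 2
      = (‖affineWeight J x‖ ^ 2)⁻¹ * ‖g x‖ ^ 2 := by
        rw [norm_mul, norm_inv, RCLike.norm_conj, mul_pow, inv_pow]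
    _ ≤ 2 * (J.bracket x ^ 2)⁻¹ * ‖g x‖ ^ 2 := by
        gcongr; exact inv_norm_sq_affineWeight_le J x
    _ = _ := by ring

end affineWeight

/-- The properties of a wave packet for the tile `P`, with frequency support in the closure of its
frequency interval, which the estimates use. -/
structure IsPacket (D : ℝ) (P : Tile) (φ : ℝ → ℂ) : Prop extends IsBump 5 D P.space φ where
  support : Function.support (𝓕 φ) ⊆ P.freq.dilate 1

namespace IsPacket

variable {D : ℝ} {P : Tile} {J : DyadicInterval} {φ : ℝ → ℂ}

theorem isBump (h : IsPacket D P φ) : IsBump 4 D P.space φ := h.toIsBump.mono (by norm_num)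

theorem integrable (h : IsPacket D P φ) : Integrable φ := (h.isBump.mono (by norm_num)).integrable

theorem isBump_affineWeight_mul (h : IsPacket D P φ) (hJ : P.space.toSet ⊆ J.toSet) :
    IsBump 4 (2 * D) P.space (fun x => affineWeight J x * φ x) where
  continuous := (continuous_affineWeight J).mul h.continuous
  bound x := by
    have h0 := P.space.bracket_pos x
    rw [norm_mul]
    calc ‖affineWeight J x‖ * ‖φ x‖
        ≤ (2 * P.space.bracket x) * (D * (√P.space.length)⁻¹ * (P.space.bracket x ^ 5)⁻¹) := by
          gcongr
          · exact (norm_affineWeight_le J x).trans (DyadicInterval.bracket_le_of_subset hJ x)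
          · exact h.bound x
      _ = _ := by field_simp

theorem integrable_affineWeight_mul (h : IsPacket D P φ) (hJ : P.space.toSet ⊆ J.toSet) :
    Integrable fun x => affineWeight J x * φ x :=
  ((h.isBump_affineWeight_mul hJ).mono (by norm_num)).integrable

theorem integrable_smul (h : IsPacket D P φ) : Integrable fun x : ℝ => x • φ x := by
  set I := P.space
  have hI : (I.length : ℂ) ≠ 0 := by exact_mod_cast I.length_pos.ne'
  have decomp : (fun x : ℝ => x • φ x) = fun x =>
      (-Complex.I * I.length) * (affineWeight I x * φ x) +
        (I.center + Complex.I * I.length) * φ x := by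
    funext x
    simp only [affineWeight, Complex.real_smul]
    push_cast
    field_simp
    linear_combination (x - I.center) * φ x * Complex.I_sq
  rw [decomp]
  exact ((h.integrable_affineWeight_mul subset_rfl).const_mul _).add (h.integrable.const_mul _)

theorem support_fourier_affineWeight_mul (h : IsPacket D P φ) :
    Function.support (𝓕 fun x => affineWeight J x * φ x) ⊆ P.freq.dilate 1 := by
  have decomp : (fun x => affineWeight J x * φ x) =
      (1 - J.center / J.length * Complex.I) • φ +
        (Complex.I / J.length) • fun x : ℝ => x • φ x := by
    have hJ : (J.length : ℂ) ≠ 0 := by exact_mod_cast J.length_pos.ne'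
    funext x
    simp only [affineWeight, Pi.add_apply, Pi.smul_apply, Complex.real_smul, smul_eq_mul]
    push_cast
    field_simp
    ring
  have fourier_decomp : 𝓕 (fun x => affineWeight J x * φ x) =
      (1 - J.center / J.length * Complex.I) • 𝓕 φ +
        (Complex.I / J.length) • 𝓕 fun x : ℝ => x • φ x := by
    rw [decomp]
    refine (VectorFourier.fourierIntegral_add Real.continuous_fourierChar continuous_inner
      (h.integrable.smul _) (h.integrable_smul.smul _)).trans ?_
    exact congrArg₂ _ (VectorFourier.fourierIntegral_const_smul ..)
      (VectorFourier.fourierIntegral_const_smul ..)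
  rw [fourier_decomp]
  refine (Function.support_add _ _).trans (Set.union_subset ?_ ?_)
  · exact (Function.support_const_smul_subset _ _).trans h.support
  · exact (Function.support_const_smul_subset _ _).trans (support_fourier_smul_subset
      h.integrable h.integrable_smul Metric.isClosed_closedBall h.support)

end IsPacket

namespace Tile

variable {P Q : Tile}

theorem freq_length (P : Tile) : P.freq.length = P.space.length⁻¹ :=
  eq_inv_of_mul_eq_one_right P.area

/-- The usual order on tiles: `P ≤ Q` if the spatial interval of `P` lies in that of `Q` and the
frequency interval of `Q` lies in that of `P`. -/
instance : Preorder Tile where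
  le P Q := P.space.toSet ⊆ Q.space.toSet ∧ Q.freq.toSet ⊆ P.freq.toSet
  le_refl _ := ⟨subset_rfl, subset_rfl⟩
  le_trans _ _ _ h h' := ⟨h.1.trans h'.1, h'.2.trans h.2⟩

theorem freq_subset_of_not_disjoint (hl : P.space.length ≤ Q.space.length)
    (h : ¬ Disjoint P.freq.toSet Q.freq.toSet) : Q.freq.toSet ⊆ P.freq.toSet := by
  refine DyadicInterval.subset_of_not_disjoint ?_ fun hd => h hd.symm
  rw [P.freq_length, Q.freq_length]
  exact inv_anti₀ P.space.length_pos hl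

theorem disjoint_space_of_not_le (hPQ : ¬ P ≤ Q) (hQP : ¬ Q ≤ P)
    (h : ¬ Disjoint P.freq.toSet Q.freq.toSet) : Disjoint P.space.toSet Q.space.toSet := by
  by_contra hs
  rcases le_total P.space.length Q.space.length with hl | hl
  · exact hPQ ⟨DyadicInterval.subset_of_not_disjoint hl hs, freq_subset_of_not_disjoint hl h⟩
  · exact hQP ⟨DyadicInterval.subset_of_not_disjoint hl fun hd => hs hd.symm,
      freq_subset_of_not_disjoint hl fun hd => h hd.symm⟩

end Tile

theorem IsPacket.not_disjoint_freq {D : ℝ} {P Q : Tile} {φ ψ : ℝ → ℂ} (hφ : IsPacket D P φ)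
    (hψ : IsPacket D Q ψ) (h : pairing φ ψ ≠ 0) : ¬ Disjoint P.freq.toSet Q.freq.toSet :=
  fun hd => h (pairing_eq_zero_of_disjoint hφ.continuous hφ.integrable hψ.integrable
    hφ.support hψ.support hd)

section Bessel

variable {ι : Type*} {s : Finset ι} {P : ι → Tile} {φ : ι → ℝ → ℂ} {D : ℝ}

theorem sum_norm_pairing_sq_le_of_column (hφ : ∀ i ∈ s, IsPacket D (P i) (φ i))
    {J : DyadicInterval} (hJ : ∀ i ∈ s, (P i).space.toSet ⊆ J.toSet)
    (hd : ∀ i ∈ s, ∀ j ∈ s, i ≠ j → Disjoint (P i).freq.toSet (P j).freq.toSet ∨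
      (P i).freq = (P j).freq ∧ Disjoint (P i).space.toSet (P j).space.toSet)
    {g : ℝ → ℂ} (hg : MemLp g 2) :
    ∑ i ∈ s, ‖pairing g (φ i)‖ ^ 2 ≤ 2048 * D ^ 2 * ∫ x, ‖g x‖ ^ 2 * (J.bracket x ^ 2)⁻¹ := by
  let v : ι → ℝ → ℂ := fun i x => affineWeight J x * φ i x
  have freq_eq : ∀ i ∈ s, ∀ j ∈ s, pairing (v j) (v i) ≠ 0 → (P j).freq = (P i).freq := by
    intro i hi j hj hne
    by_contra hfreq
    rcases hd j hj i hi (fun h => hfreq (h ▸ rfl)) with h | h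
    · exact hne (pairing_eq_zero_of_disjoint
        ((hφ j hj).isBump_affineWeight_mul (hJ j hj)).continuous
        ((hφ j hj).integrable_affineWeight_mul (hJ j hj))
        ((hφ i hi).integrable_affineWeight_mul (hJ i hi))
        (hφ j hj).support_fourier_affineWeight_mul (hφ i hi).support_fourier_affineWeight_mul h)
    · exact hfreq h.1
  have bessel := sum_norm_pairing_sq_le s (fun i => (P i).space) v
    (fun i hi => (hφ i hi).isBump_affineWeight_mul (hJ i hi))
    (memLp_inv_affineWeight_mul (J := J) hg)
    (fun i hi j hj k hk hjk => by
      have hj' := freq_eq i hi j hj.1 hj.2.2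
      have hk' := freq_eq i hi k hk.1 hk.2.2
      refine ((hd j hj.1 k hk.1 hjk).resolve_left ?_).2
      rw [hj', hk', Set.not_disjoint_iff]
      exact ⟨_, (P i).freq.center_mem, (P i).freq.center_mem⟩)
    (fun i hi j hj _ hne => Or.inl (inv_injective (by
      rw [← Tile.freq_length, ← Tile.freq_length, freq_eq i hi j hj hne])))
  calc ∑ i ∈ s, ‖pairing g (φ i)‖ ^ 2
      ≤ 256 * (2 * D) ^ 2 * ∫ x, ‖(starRingEnd ℂ (affineWeight J x))⁻¹ * g x‖ ^ 2 := by
        simpa only [pairing_eq_pairing_affineWeight_mul J g] using bessel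
    _ ≤ 256 * (2 * D) ^ 2 * (2 * ∫ x, ‖g x‖ ^ 2 * (J.bracket x ^ 2)⁻¹) := by
        gcongr
        exact integral_sq_inv_affineWeight_mul_le hg
    _ = _ := by ring

theorem sum_length_le_of_not_le {κ : ℝ} (hκ : 0 ≤ κ) (hφ : ∀ i ∈ s, IsPacket D (P i) (φ i))
    (hd : ∀ i ∈ s, ∀ j ∈ s, i ≠ j → ¬ P i ≤ P j) {f : ℝ → ℂ} (hf : MemLp f 2)
    (hlow : ∀ i ∈ s, κ * √(P i).space.length ≤ ‖pairing f (φ i)‖)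
    (hup : ∀ i ∈ s, ‖pairing f (φ i)‖ ≤ 2 * κ * √(P i).space.length) :
    κ ^ 2 * ∑ i ∈ s, (P i).space.length ≤ 256 * D ^ 2 * ∫ x, ‖f x‖ ^ 2 := by
  have bessel := sum_norm_pairing_sq_le s (fun i => (P i).space) φ
    (fun i hi => (hφ i hi).isBump) hf
    (fun i hi j hj k hk hjk => by
      have hj' := Tile.freq_subset_of_not_disjoint hj.2.1 ((hφ j hj.1).not_disjoint_freq
        (hφ i hi) hj.2.2) (P i).freq.center_mem
      have hk' := Tile.freq_subset_of_not_disjoint hk.2.1 ((hφ k hk.1).not_disjoint_freq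
        (hφ i hi) hk.2.2) (P i).freq.center_mem
      exact Tile.disjoint_space_of_not_le (hd j hj.1 k hk.1 hjk) (hd k hk.1 j hj.1 hjk.symm)
        (Set.not_disjoint_iff.2 ⟨_, hj', hk'⟩))
    (fun i hi j hj _ _ => Or.inr <| calc
      ‖pairing f (φ j)‖ * √(P i).space.length
        ≤ (2 * κ * √(P j).space.length) * √(P i).space.length := by gcongr; exact hup j hj
      _ = 2 * (κ * √(P i).space.length) * √(P j).space.length := by ring
      _ ≤ 2 * ‖pairing f (φ i)‖ * √(P j).space.length := by gcongr; exact hlow i hi)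
  refine le_trans ?_ bessel
  rw [Finset.mul_sum]
  refine Finset.sum_le_sum fun i hi => ?_
  calc κ ^ 2 * (P i).space.length = (κ * √(P i).space.length) ^ 2 := by
        rw [mul_pow, Real.sq_sqrt (P i).space.length_pos.le]
    _ ≤ _ := by
        gcongr
        exact hlow i hi

end Bessel

/-- The points which are the center of some ball in which the measure `μ` has average density more
than `δ`: a superlevel set of the centered maximal function of `μ`. -/
def denseSet (μ : Measure ℝ) (δ : ℝ) : Set ℝ :=
  {x | ∃ ρ > 0, ENNReal.ofReal (2 * δ * ρ) < μ (Metric.closedBall x ρ)}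

theorem volume_denseSet_mul_le (μ : Measure ℝ) [IsFiniteMeasure μ] {δ : ℝ} (hδ : 0 < δ) :
    volume (denseSet μ δ) * ENNReal.ofReal δ ≤ 5 * μ Set.univ := by
  have hdense : ∀ x ∈ denseSet μ δ, ∃ ρ > 0,
    ENNReal.ofReal (2 * δ * ρ) < μ (Metric.closedBall x ρ) := fun x hx => hx
  choose! ρ hρ hμ using hdense
  have radius_le : ∀ x ∈ denseSet μ δ, ρ x ≤ μ.real Set.univ / (2 * δ) := by
    intro x hx
    rw [le_div_iff₀' (by positivity), measureReal_def,
      ← ENNReal.ofReal_le_iff_le_toReal (measure_ne_top _ _)]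
    exact (hμ x hx).le.trans (measure_mono (Set.subset_univ _))
  obtain ⟨u, hu, hdisj, hcover⟩ := Vitali.exists_disjoint_subfamily_covering_enlargement_closedBall
    (denseSet μ δ) id ρ _ radius_le 5 (by norm_num)
  have hcount : u.Countable := hdisj.countable_of_nonempty_interior fun x hx => by
    rw [interior_closedBall _ (hρ x (hu hx)).ne']
    exact Metric.nonempty_ball.2 (hρ x (hu hx))
  have subset_enlargement : denseSet μ δ ⊆ ⋃ x ∈ u, Metric.closedBall x (5 * ρ x) := by
    intro x hx
    obtain ⟨y, hy, hxy⟩ := hcover x hx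
    exact Set.mem_biUnion hy (hxy (Metric.mem_closedBall_self (hρ x hx).le))
  calc volume (denseSet μ δ) * ENNReal.ofReal δ
      ≤ (∑' x : u, volume (Metric.closedBall (x : ℝ) (5 * ρ x))) * ENNReal.ofReal δ := by
        gcongr
        exact (measure_mono subset_enlargement).trans (measure_biUnion_le _ hcount _)
    _ = ∑' x : u, 5 * ENNReal.ofReal (2 * δ * ρ x) := by
        rw [← ENNReal.tsum_mul_right]
        refine tsum_congr fun x => ?_
        have hx := (hρ x (hu x.2)).le
        rw [Real.volume_closedBall, ← ENNReal.ofReal_mul (by positivity),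
          ← ENNReal.ofReal_ofNat 5, ← ENNReal.ofReal_mul (by norm_num)]
        congr 1; ring
    _ ≤ ∑' x : u, 5 * μ (Metric.closedBall (x : ℝ) (ρ x)) := by
        gcongr with x
        exact (hμ x (hu x.2)).le
    _ = 5 * μ (⋃ x ∈ u, Metric.closedBall x (ρ x)) := by
        rw [ENNReal.tsum_mul_left]
        exact congrArg _ (measure_biUnion hcount hdisj fun x _ => measurableSet_closedBall).symm
    _ ≤ 5 * μ Set.univ := by
        gcongr
        exact Set.subset_univ _

theorem ofReal_inv_bracket_sq_le (I : DyadicInterval) (x : ℝ) :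
    ENNReal.ofReal ((I.bracket x ^ 2)⁻¹) ≤ ∑' j : ℕ, ENNReal.ofReal (4 * (4 ^ j)⁻¹) *
      (Metric.closedBall I.center (2 ^ j * I.length)).indicator 1 x := by
  classical
  have hI := I.length_pos
  have hex : ∃ j : ℕ, |x - I.center| / I.length ≤ 2 ^ j :=
    (pow_unbounded_of_one_lt _ one_lt_two).imp fun _ => le_of_lt
  refine le_trans ?_ (ENNReal.le_tsum (Nat.find hex))
  rw [Set.indicator_of_mem (by
    rw [Metric.mem_closedBall, Real.dist_eq, ← div_le_iff₀ hI]; exact Nat.find_spec hex),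
    Pi.one_apply, mul_one]
  refine ENNReal.ofReal_le_ofReal ?_
  rcases hk : Nat.find hex with _ | k
  · rw [pow_zero, inv_one, mul_one]
    exact (inv_le_one_of_one_le₀ (one_le_pow₀ (I.one_le_bracket x))).trans (by norm_num)
  · have far : (2 : ℝ) ^ k < |x - I.center| / I.length :=
      not_le.1 (Nat.find_min hex (by omega))
    calc (I.bracket x ^ 2)⁻¹ ≤ ((2 ^ k) ^ 2)⁻¹ := by
          gcongr
          unfold DyadicInterval.bracket
          linarith
      _ = 4 * (4 ^ (k + 1))⁻¹ := by
          rw [pow_right_comm, pow_succ _ k]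
          norm_num
          ring

section bracketIntegral

variable {μ : Measure ℝ} {δ : ℝ} (hδ : 0 ≤ δ) (I : DyadicInterval) {x₀ : ℝ}
  (hx₀ : x₀ ∉ denseSet μ δ)

include hδ hx₀

theorem measure_closedBall_le (j : ℕ) :
    μ (Metric.closedBall I.center (2 ^ j * I.length)) ≤
      ENNReal.ofReal (4 * δ * I.bracket x₀ * 2 ^ j * I.length) := by
  have hI := I.length_pos
  have hb := I.one_le_bracket x₀
  have ball_subset : Metric.closedBall I.center (2 ^ j * I.length) ⊆
      Metric.closedBall x₀ ((2 ^ j + I.bracket x₀) * I.length) := by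
    refine Metric.closedBall_subset_closedBall' ?_
    rw [dist_comm, Real.dist_eq, add_mul]
    have : I.bracket x₀ * I.length = I.length + |x₀ - I.center| := by
      unfold DyadicInterval.bracket; field_simp
    linarith
  have density_le : μ (Metric.closedBall x₀ ((2 ^ j + I.bracket x₀) * I.length)) ≤
      ENNReal.ofReal (2 * δ * ((2 ^ j + I.bracket x₀) * I.length)) :=
    not_lt.1 fun h => hx₀ ⟨_, by positivity, h⟩
  refine (measure_mono ball_subset).trans (density_le.trans (ENNReal.ofReal_le_ofReal ?_))
  have : (2 : ℝ) ^ j + I.bracket x₀ ≤ 2 * (I.bracket x₀ * 2 ^ j) := by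
    nlinarith [one_le_pow₀ (n := j) (one_le_two : (1 : ℝ) ≤ 2)]
  calc 2 * δ * ((2 ^ j + I.bracket x₀) * I.length)
      ≤ 2 * δ * (2 * (I.bracket x₀ * 2 ^ j) * I.length) := by gcongr
    _ = _ := by ring

theorem lintegral_inv_bracket_sq_le :
    ∫⁻ x, ENNReal.ofReal ((I.bracket x ^ 2)⁻¹) ∂μ ≤
      ENNReal.ofReal (32 * δ * I.length * I.bracket x₀) := by
  have hI := I.length_pos
  have hb := I.bracket_pos x₀
  calc ∫⁻ x, ENNReal.ofReal ((I.bracket x ^ 2)⁻¹) ∂μ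
      ≤ ∫⁻ x, ∑' j : ℕ, ENNReal.ofReal (4 * (4 ^ j)⁻¹) *
        (Metric.closedBall I.center (2 ^ j * I.length)).indicator 1 x ∂μ :=
        lintegral_mono (ofReal_inv_bracket_sq_le I)
    _ = ∑' j : ℕ, ENNReal.ofReal (4 * (4 ^ j)⁻¹) *
        μ (Metric.closedBall I.center (2 ^ j * I.length)) := by
        rw [lintegral_tsum fun j =>
          ((measurable_one.indicator measurableSet_closedBall).const_mul _).aemeasurable]
        refine tsum_congr fun j => ?_
        rw [lintegral_const_mul _ (measurable_one.indicator measurableSet_closedBall),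
          lintegral_indicator_one measurableSet_closedBall]
    _ ≤ ∑' j : ℕ, ENNReal.ofReal (16 * δ * I.length * I.bracket x₀ * (1 / 2) ^ j) := by
        refine ENNReal.tsum_le_tsum fun j => ?_
        refine (mul_le_mul_right (measure_closedBall_le hδ I hx₀ j) _).trans_eq ?_
        have : ((4 : ℝ) ^ j)⁻¹ = (1 / 2) ^ j * (2 ^ j)⁻¹ := by
          rw [one_div, inv_pow, ← mul_inv, ← mul_pow]; norm_num
        rw [← ENNReal.ofReal_mul (by positivity), this]
        congr 1
        field_simp
        ring
    _ = _ := by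
        rw [← ENNReal.ofReal_tsum_of_nonneg (fun j => by positivity)
          (summable_geometric_two.mul_left _), tsum_mul_left, tsum_geometric_two]
        congr 1; ring

end bracketIntegral

/-- One plus the distance of the center of `I` from `A`, in units of `|I|`. -/
noncomputable def remoteness (A : Set ℝ) (I : DyadicInterval) : ℝ :=
  1 + Metric.infDist I.center A / I.length

section remoteness

variable {A : Set ℝ} {I J : DyadicInterval}

theorem one_le_remoteness (A : Set ℝ) (I : DyadicInterval) : 1 ≤ remoteness A I :=
  le_add_of_nonneg_right (div_nonneg Metric.infDist_nonneg I.length_pos.le)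

theorem remoteness_pos (A : Set ℝ) (I : DyadicInterval) : 0 < remoteness A I :=
  zero_lt_one.trans_le (one_le_remoteness A I)

theorem remoteness_le_bracket {x : ℝ} (hx : x ∈ A) : remoteness A I ≤ I.bracket x := by
  have hI := I.length_pos
  unfold remoteness DyadicInterval.bracket
  gcongr
  rw [← Real.dist_eq, dist_comm]
  exact Metric.infDist_le_dist_of_mem hx

theorem exists_bracket_le_remoteness (hA : A.Nonempty) (I : DyadicInterval) :
    ∃ x ∈ A, I.bracket x ≤ 2 * remoteness A I := by
  have hI := I.length_pos
  obtain ⟨x, hx, hdist⟩ := (Metric.infDist_lt_iff hA).1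
    (lt_add_of_pos_right (Metric.infDist I.center A) hI)
  refine ⟨x, hx, ?_⟩
  have hquot : |x - I.center| / I.length ≤ 1 + Metric.infDist I.center A / I.length := by
    rw [← Real.dist_eq, dist_comm, div_le_iff₀ hI, add_mul, div_mul_cancel₀ _ hI.ne']
    linarith
  have := div_nonneg (Metric.infDist_nonneg (x := I.center) (s := A)) hI.le
  unfold DyadicInterval.bracket remoteness
  linarith

theorem remoteness_le_of_subset (hA : A.Nonempty) (h : J.toSet ⊆ I.toSet) :
    remoteness A I ≤ 4 * remoteness A J := by
  obtain ⟨x, hx, hle⟩ := exists_bracket_le_remoteness hA J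
  linarith [remoteness_le_bracket hx (I := I), DyadicInterval.bracket_le_of_subset h x]

end remoteness

/-- The hypotheses on one of the two functions: it is bounded by the indicator function of the set
`F` of finite measure, and `F` has density at most `δ` in the balls centered in `A`. -/
structure IsRestricted (A : Set ℝ) (δ : ℝ) (F : Set ℝ) (f : ℝ → ℂ) : Prop where
  measurableSet : MeasurableSet F
  volume_lt_top : volume F < ∞
  nonneg : 0 ≤ δ
  notMem_denseSet : ∀ x ∈ A, x ∉ denseSet (volume.restrict F) δ
  aestronglyMeasurable : AEStronglyMeasurable f
  norm_le : ∀ᵐ x, ‖f x‖ ≤ F.indicator 1 x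

namespace IsRestricted

variable {A F : Set ℝ} {δ : ℝ} {f : ℝ → ℂ}

theorem memLp (hf : IsRestricted A δ F f) : MemLp f 2 := by
  refine (memLp_indicator_const 2 hf.measurableSet (1 : ℝ) (.inr hf.volume_lt_top.ne)).of_le
    hf.aestronglyMeasurable ?_
  filter_upwards [hf.norm_le] with x hx
  exact hx.trans (Real.le_norm_self _)

theorem integral_sq_mul_le (hf : IsRestricted A δ F f) {w : ℝ → ℝ} (hw : 0 ≤ w)
    (hwF : IntegrableOn w F) : ∫ x, ‖f x‖ ^ 2 * w x ≤ ∫ x in F, w x := by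
  rw [← integral_indicator hf.measurableSet]
  refine integral_mono_of_nonneg (Filter.Eventually.of_forall fun x =>
    mul_nonneg (by positivity) (hw x)) (hwF.integrable_indicator hf.measurableSet) ?_
  filter_upwards [hf.norm_le] with x hx
  by_cases h : x ∈ F
  · rw [Set.indicator_of_mem h] at hx ⊢
    exact mul_le_of_le_one_left (hw x) (pow_le_one₀ (norm_nonneg _) hx)
  · rw [Set.indicator_of_notMem h] at hx ⊢
    rw [le_antisymm hx (norm_nonneg _), zero_pow two_ne_zero, zero_mul]

theorem integral_sq_le (hf : IsRestricted A δ F f) : ∫ x, ‖f x‖ ^ 2 ≤ volume.real F := by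
  simpa using hf.integral_sq_mul_le (w := 1) (fun _ => zero_le_one)
    (integrableOn_const hf.volume_lt_top.ne)

theorem setIntegral_inv_bracket_sq_le (hf : IsRestricted A δ F f) (hA : A.Nonempty)
    (I : DyadicInterval) :
    ∫ x in F, (I.bracket x ^ 2)⁻¹ ≤ 64 * I.length * remoteness A I * min 1 δ := by
  have hI := I.length_pos
  have hr := one_le_remoteness A I
  have hδ := hf.nonneg
  rw [integral_eq_lintegral_of_nonneg_ae (Filter.Eventually.of_forall fun x => by positivity)
    I.integrable_bracket.aestronglyMeasurable.restrict]
  refine ENNReal.toReal_le_of_le_ofReal (by positivity) ?_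
  rcases le_total 1 δ with h1 | h1
  · refine (setLIntegral_le_lintegral _ _).trans ((lintegral_decay_le hI I.center).trans ?_)
    rw [min_eq_left h1]
    exact ENNReal.ofReal_le_ofReal (by nlinarith)
  · obtain ⟨x, hx, hle⟩ := exists_bracket_le_remoteness hA I
    refine (lintegral_inv_bracket_sq_le hδ I (hf.notMem_denseSet x hx)).trans ?_
    rw [min_eq_right h1]
    refine ENNReal.ofReal_le_ofReal ?_
    calc 32 * δ * I.length * I.bracket x ≤ 32 * δ * I.length * (2 * remoteness A I) := by gcongr
      _ = _ := by ring

theorem norm_pairing_le (hf : IsRestricted A δ F f) (hA : A.Nonempty) {D : ℝ}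
    {I : DyadicInterval} {φ : ℝ → ℂ} (hφ : IsBump 2 D I φ) :
    ‖pairing f φ‖ ≤ √I.length * (64 * D * remoteness A I * min 1 δ) := by
  have hD := hφ.nonneg
  have hI := I.length_pos
  calc ‖pairing f φ‖
      ≤ ∫ x, F.indicator (fun x => D * (√I.length)⁻¹ * (I.bracket x ^ 2)⁻¹) x := by
        refine norm_integral_le_of_norm_le ((I.integrable_bracket.const_mul _).indicator
          hf.measurableSet) ?_
        filter_upwards [hf.norm_le] with x hx
        rw [norm_mul, RCLike.norm_conj]
        by_cases h : x ∈ F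
        · rw [Set.indicator_of_mem h] at hx ⊢
          exact (mul_le_of_le_one_left (norm_nonneg _) hx).trans (hφ.bound x)
        · rw [Set.indicator_of_notMem h] at hx ⊢
          rw [le_antisymm hx (norm_nonneg _), zero_mul]
    _ = D * (√I.length)⁻¹ * ∫ x in F, (I.bracket x ^ 2)⁻¹ := by
        rw [integral_indicator hf.measurableSet, integral_const_mul]
    _ ≤ D * (√I.length)⁻¹ * (64 * I.length * remoteness A I * min 1 δ) := by
        gcongr
        exact hf.setIntegral_inv_bracket_sq_le hA I
    _ = I.length / √I.length * (64 * D * remoteness A I * min 1 δ) := by ring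
    _ = _ := by rw [Real.div_sqrt]

end IsRestricted

theorem exists_antichain_le {ι α : Type*} [Preorder α] (P : ι → α) (S : Finset ι) :
    ∃ R ⊆ S, (∀ i ∈ R, ∀ j ∈ R, i ≠ j → ¬ P i ≤ P j) ∧ ∀ i ∈ S, ∃ m ∈ R, P i ≤ P m := by
  classical
  induction S using Finset.induction_on with
  | empty => exact ⟨∅, subset_rfl, by simp, by simp⟩
  | insert a S _ ih =>
    obtain ⟨R, hRS, hanti, hcover⟩ := ih
    by_cases ha : ∃ m ∈ R, P a ≤ P m
    · exact ⟨R, hRS.trans (Finset.subset_insert a S), hanti,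
        (Finset.forall_mem_insert ..).2 ⟨ha, hcover⟩⟩
    · push Not at ha
      refine ⟨insert a {m ∈ R | ¬ P m ≤ P a},
        Finset.insert_subset_insert a ((Finset.filter_subset _ R).trans hRS), ?_, ?_⟩
      · grind
      · intro i hi
        rcases Finset.mem_insert.1 hi with rfl | hi
        · exact ⟨i, Finset.mem_insert_self i _, le_rfl⟩
        obtain ⟨m, hm, him⟩ := hcover i hi
        by_cases hma : P m ≤ P a
        · exact ⟨a, Finset.mem_insert_self a _, him.trans hma⟩
        · exact ⟨m, Finset.mem_insert_of_mem (Finset.mem_filter.2 ⟨hm, hma⟩), him⟩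

/-- Two families of packets, for the tiles `P s` and `Q s` over the same spatial interval, whose
frequency squares are pairwise disjoint or equal; the tiles over one square are disjoint in
space. -/
structure IsBitileFamily {ι : Type*} (D : ℝ) (S : Finset ι) (P Q : ι → Tile)
    (φ ψ : ι → ℝ → ℂ) : Prop where
  space_eq : ∀ s ∈ S, (P s).space = (Q s).space
  fst : ∀ s ∈ S, IsPacket D (P s) (φ s)
  snd : ∀ s ∈ S, IsPacket D (Q s) (ψ s)
  disjoint : ∀ s ∈ S, ∀ t ∈ S, s ≠ t → Disjoint (P s).freq.toSet (P t).freq.toSet ∨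
    Disjoint (Q s).freq.toSet (Q t).freq.toSet ∨ (P s).freq = (P t).freq ∧
      (Q s).freq = (Q t).freq ∧ Disjoint (P s).space.toSet (P t).space.toSet

namespace IsBitileFamily

variable {ι : Type*} {D : ℝ} {S : Finset ι} {P Q : ι → Tile} {φ ψ : ι → ℝ → ℂ}

theorem swap (h : IsBitileFamily D S P Q φ ψ) : IsBitileFamily D S Q P ψ φ where
  space_eq s hs := (h.space_eq s hs).symm
  fst := h.snd
  snd := h.fst
  disjoint s hs t ht hst := by
    rw [← h.space_eq s hs, ← h.space_eq t ht]
    have := h.disjoint s hs t ht hst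
    tauto

theorem mono (h : IsBitileFamily D S P Q φ ψ) {T : Finset ι} (hT : T ⊆ S) :
    IsBitileFamily D T P Q φ ψ where
  space_eq s hs := h.space_eq s (hT hs)
  fst s hs := h.fst s (hT hs)
  snd s hs := h.snd s (hT hs)
  disjoint s hs t ht := h.disjoint s (hT hs) t (hT ht)

variable {A F G : Set ℝ} {δ δ' κ : ℝ} {f g : ℝ → ℂ}

/- Below a common top `m` the first frequency intervals all contain that of `m`, so the second ones
belonging to distinct squares are disjoint. -/
theorem sum_below_le (h : IsBitileFamily D S P Q φ ψ) (hA : A.Nonempty)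
    (hg : IsRestricted A δ' G g) {m : Tile} (hm : ∀ s ∈ S, P s ≤ m) :
    ∑ s ∈ S, ‖pairing g (ψ s)‖ ^ 2 * (remoteness A (P s).space)⁻¹ ≤
      2 ^ 19 * D ^ 2 * min 1 δ' * m.space.length := by
  have hr := remoteness_pos A m.space
  have hI := m.space.length_pos
  have column : ∑ s ∈ S, ‖pairing g (ψ s)‖ ^ 2 ≤
      2048 * D ^ 2 * ∫ x, ‖g x‖ ^ 2 * (m.space.bracket x ^ 2)⁻¹ := by
    refine sum_norm_pairing_sq_le_of_column h.snd
      (fun s hs => h.space_eq s hs ▸ (hm s hs).1) (fun s hs t ht hst => ?_) hg.memLp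
    rcases h.disjoint s hs t ht hst with hd | hd | ⟨_, hfreq, hspace⟩
    · exact absurd hd (Set.not_disjoint_iff.2
        ⟨_, (hm s hs).2 m.freq.center_mem, (hm t ht).2 m.freq.center_mem⟩)
    · exact .inl hd
    · rw [h.space_eq s hs, h.space_eq t ht] at hspace
      exact .inr ⟨hfreq, hspace⟩
  calc ∑ s ∈ S, ‖pairing g (ψ s)‖ ^ 2 * (remoteness A (P s).space)⁻¹
      ≤ ∑ s ∈ S, ‖pairing g (ψ s)‖ ^ 2 * (4 * (remoteness A m.space)⁻¹) := by
        refine Finset.sum_le_sum fun s hs => ?_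
        gcongr
        have hs' := remoteness_pos A (P s).space
        rw [← div_eq_mul_inv, inv_le_comm₀ hs' (by positivity), inv_div, div_le_iff₀' four_pos]
        exact remoteness_le_of_subset hA (hm s hs).1
    _ = (∑ s ∈ S, ‖pairing g (ψ s)‖ ^ 2) * (4 * (remoteness A m.space)⁻¹) := by
        rw [Finset.sum_mul]
    _ ≤ (2048 * D ^ 2 * (64 * m.space.length * remoteness A m.space * min 1 δ')) *
          (4 * (remoteness A m.space)⁻¹) := by
        gcongr
        refine column.trans ?_
        gcongr
        exact (hg.integral_sq_mul_le (fun x => by positivity)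
          m.space.integrable_bracket.integrableOn).trans (hg.setIntegral_inv_bracket_sq_le hA _)
    _ = _ := by field_simp; ring

theorem sq_mul_sum_layer_le (h : IsBitileFamily D S P Q φ ψ) (hA : A.Nonempty)
    (hf : IsRestricted A δ F f) (hg : IsRestricted A δ' G g) (hκ : 0 ≤ κ)
    (hlow : ∀ s ∈ S, κ * √(P s).space.length ≤ ‖pairing f (φ s)‖)
    (hup : ∀ s ∈ S, ‖pairing f (φ s)‖ ≤ 2 * κ * √(P s).space.length) :
    κ ^ 2 * ∑ s ∈ S, ‖pairing g (ψ s)‖ ^ 2 * (remoteness A (P s).space)⁻¹ ≤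
      2 ^ 27 * D ^ 4 * volume.real F * min 1 δ' := by
  classical
  have hmin : 0 ≤ min 1 δ' := le_min zero_le_one hg.nonneg
  obtain ⟨R, hRS, hanti, hcover⟩ := exists_antichain_le P S
  have tops : κ ^ 2 * ∑ m ∈ R, (P m).space.length ≤ 256 * D ^ 2 * volume.real F :=
    (sum_length_le_of_not_le hκ (fun m hm => h.fst m (hRS hm)) hanti hf.memLp
      (fun m hm => hlow m (hRS hm)) (fun m hm => hup m (hRS hm))).trans
      (by gcongr; exact hf.integral_sq_le)
  set c : ι → ℝ := fun s => ‖pairing g (ψ s)‖ ^ 2 * (remoteness A (P s).space)⁻¹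
  have c_nonneg (s : ι) : 0 ≤ c s :=
    mul_nonneg (by positivity) (inv_nonneg.2 (remoteness_pos A _).le)
  have columns : ∑ s ∈ S, c s ≤ ∑ m ∈ R, ∑ s ∈ S with P s ≤ P m, c s := by
    simp only [Finset.sum_filter]
    rw [Finset.sum_comm]
    refine Finset.sum_le_sum fun s hs => ?_
    obtain ⟨m, hm, hle⟩ := hcover s hs
    calc c s = if P s ≤ P m then c s else 0 := (if_pos hle).symm
      _ ≤ _ := Finset.single_le_sum (f := fun m => if P s ≤ P m then c s else 0)
        (fun m _ => by split_ifs; exacts [c_nonneg s, le_rfl]) hm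
  calc κ ^ 2 * ∑ s ∈ S, c s
      ≤ κ ^ 2 * ∑ m ∈ R, 2 ^ 19 * D ^ 2 * min 1 δ' * (P m).space.length := by
        gcongr
        exact columns.trans (Finset.sum_le_sum fun m _ =>
          (h.mono (Finset.filter_subset _ S)).sum_below_le hA hg
            fun s hs => (Finset.mem_filter.1 hs).2)
    _ = 2 ^ 19 * D ^ 2 * min 1 δ' * (κ ^ 2 * ∑ m ∈ R, (P m).space.length) := by
        rw [← Finset.mul_sum]; ring
    _ ≤ 2 ^ 19 * D ^ 2 * min 1 δ' * (256 * D ^ 2 * volume.real F) := by gcongr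
    _ = _ := by ring

end IsBitileFamily

section dyadicSum

variable {ε Y : ℝ}

/-- The constant of the two-sided geometric sum over the dyadic scales in
`sum_zpow_rpow_mul_min_le`. -/
noncomputable def dyadicSumConst (ε : ℝ) : ℝ := 2 ^ ε * ∑' k : ℤ, ((2 : ℝ) ^ (-ε)) ^ k.natAbs

theorem dyadicSumConst_nonneg (ε : ℝ) : 0 ≤ dyadicSumConst ε :=
  mul_nonneg (by positivity) (tsum_nonneg fun k => by positivity)

theorem two_rpow_neg_pow (ε : ℝ) (k : ℕ) : ((2 : ℝ) ^ (-ε)) ^ k = ((2 ^ k)⁻¹) ^ ε := by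
  rw [Real.rpow_neg zero_le_two, inv_pow, Real.inv_rpow (by positivity), ← Real.rpow_natCast,
    ← Real.rpow_natCast, ← Real.rpow_mul zero_le_two, ← Real.rpow_mul zero_le_two, mul_comm]

theorem zpow_rpow_mul_min_le (hε : 0 < ε) {m : ℤ} (hm : (2 : ℝ) ^ m ≤ Y) (hm' : Y < 2 ^ (m + 1))
    (n : ℤ) : ((2 : ℝ) ^ n) ^ ε * min 1 ((Y / 2 ^ n) ^ (2 * ε)) ≤
      2 ^ ε * Y ^ ε * ((2 : ℝ) ^ (-ε)) ^ (n - m).natAbs := by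
  have hn : (0 : ℝ) < 2 ^ n := by positivity
  have hY : 0 < Y := lt_of_lt_of_le (by positivity) hm
  rw [two_rpow_neg_pow]
  rcases le_total n m with h | h
  · have scale : (2 : ℝ) ^ n = 2 ^ m * (2 ^ (n - m).natAbs)⁻¹ := by
      rw [← zpow_natCast, ← zpow_neg, ← zpow_add₀ two_ne_zero]
      congr 1; lia
    calc ((2 : ℝ) ^ n) ^ ε * min 1 ((Y / 2 ^ n) ^ (2 * ε))
        ≤ ((2 : ℝ) ^ n) ^ ε * 1 := by gcongr; exact min_le_left _ _
      _ = 1 * ((2 : ℝ) ^ m) ^ ε * ((2 ^ (n - m).natAbs)⁻¹) ^ ε := by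
        rw [mul_one, one_mul, scale, Real.mul_rpow (by positivity) (by positivity)]
      _ ≤ _ := by
        gcongr
        exact Real.one_le_rpow one_le_two hε.le
  · have scale : (2 : ℝ) ^ m = 2 ^ n * (2 ^ (n - m).natAbs)⁻¹ := by
      rw [← zpow_natCast, ← zpow_neg, ← zpow_add₀ two_ne_zero]
      congr 1; lia
    have ratio_le : Y / 2 ^ n ≤ 2 * (2 ^ (n - m).natAbs)⁻¹ := by
      rw [div_le_iff₀ hn]
      refine hm'.le.trans_eq ?_
      rw [zpow_add_one₀ two_ne_zero, scale]; ring
    calc ((2 : ℝ) ^ n) ^ ε * min 1 ((Y / 2 ^ n) ^ (2 * ε))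
        ≤ ((2 : ℝ) ^ n) ^ ε * (Y / 2 ^ n) ^ (2 * ε) := by gcongr; exact min_le_right _ _
      _ = Y ^ ε * (Y / 2 ^ n) ^ ε := by
        rw [two_mul, Real.rpow_add (by positivity), ← mul_assoc,
          ← Real.mul_rpow hn.le (by positivity), mul_div_cancel₀ _ hn.ne']
      _ ≤ Y ^ ε * (2 * (2 ^ (n - m).natAbs)⁻¹) ^ ε := by gcongr
      _ = _ := by rw [Real.mul_rpow zero_le_two (by positivity)]; ring

theorem sum_zpow_rpow_mul_min_le (hε : 0 < ε) (hY : 0 ≤ Y) (T : Finset ℤ) :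
    ∑ n ∈ T, ((2 : ℝ) ^ n) ^ ε * min 1 ((Y / 2 ^ n) ^ (2 * ε)) ≤ dyadicSumConst ε * Y ^ ε := by
  rcases hY.eq_or_lt with rfl | hY
  · simp [Real.zero_rpow hε.ne', Real.zero_rpow (mul_pos two_pos hε).ne']
  obtain ⟨m, hm, hm'⟩ := exists_mem_Ico_zpow hY (one_lt_two : (1 : ℝ) < 2)
  have hq : (2 : ℝ) ^ (-ε) < 1 := Real.rpow_lt_one_of_one_lt_of_neg one_lt_two (neg_lt_zero.2 hε)
  have hsum : Summable fun k : ℤ => ((2 : ℝ) ^ (-ε)) ^ k.natAbs := by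
    refine Summable.of_nat_of_neg ?_ ?_ <;>
      simpa using summable_geometric_of_lt_one (by positivity) hq
  calc ∑ n ∈ T, ((2 : ℝ) ^ n) ^ ε * min 1 ((Y / 2 ^ n) ^ (2 * ε))
      ≤ ∑ n ∈ T, 2 ^ ε * Y ^ ε * ((2 : ℝ) ^ (-ε)) ^ (n - m).natAbs :=
        Finset.sum_le_sum fun n _ => zpow_rpow_mul_min_le hε hm hm' n
    _ = 2 ^ ε * Y ^ ε * ∑ n ∈ T, ((2 : ℝ) ^ (-ε)) ^ (n - m).natAbs := (Finset.mul_sum ..).symm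
    _ ≤ 2 ^ ε * Y ^ ε * ∑' n : ℤ, ((2 : ℝ) ^ (-ε)) ^ (n - m).natAbs := by
        refine mul_le_mul_of_nonneg_left ?_ (by positivity)
        exact (hsum.comp_injective (i := fun n : ℤ => n - m) sub_left_injective).sum_le_tsum T
          fun n _ => by positivity
    _ = _ := by
        rw [show ∑' n : ℤ, ((2 : ℝ) ^ (-ε)) ^ (n - m).natAbs = ∑' k : ℤ, ((2 : ℝ) ^ (-ε)) ^ k.natAbs
          from (Equiv.subRight m).tsum_eq fun k : ℤ => ((2 : ℝ) ^ (-ε)) ^ k.natAbs, dyadicSumConst]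
        ring

end dyadicSum

theorem mul_damping_rpow_le {r a b l κ X Y : ℝ} (hr : 2 < r) (hb : 0 ≤ b) (hl : 1 ≤ l) (hκ : 0 < κ)
    (hκa : κ ≤ a) (haκ : a ≤ 2 * κ) (haX : a ≤ X * l) (hbY : b ≤ Y * l) :
    (a * b * (l ^ 3)⁻¹) ^ r ≤ 2 ^ r * Y ^ (r - 2) *
      (κ ^ (r - 2) * min 1 ((X / κ) ^ (2 * (r - 2)))) * (κ ^ 2 * (b ^ 2 * l⁻¹)) := by
  have hl₀ : 0 < l := zero_lt_one.trans_le hl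
  have ha : 0 ≤ a := hκ.le.trans hκa
  have hY : 0 ≤ Y := nonneg_of_mul_nonneg_left (hb.trans hbY) hl₀
  have split_rpow {x : ℝ} (hx : 0 ≤ x) : x ^ r = x ^ 2 * x ^ (r - 2) := by
    rw [← Real.rpow_two, ← Real.rpow_add_of_nonneg hx zero_le_two (by linarith)]
    congr 1; ring
  have inv_le_min : (l⁻¹) ^ (2 * (r - 2)) ≤ min 1 ((X / κ) ^ (2 * (r - 2))) := by
    refine le_min (Real.rpow_le_one (by positivity) (inv_le_one_of_one_le₀ hl) (by linarith))
      (Real.rpow_le_rpow (by positivity) ?_ (by linarith))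
    rw [le_div_iff₀ hκ, inv_mul_le_iff₀ hl₀, mul_comm l]
    exact hκa.trans haX
  have damping : l ^ (r - 2) * ((l ^ 3)⁻¹) ^ r ≤ l⁻¹ * (l⁻¹) ^ (2 * (r - 2)) := by
    rw [Real.inv_rpow (by positivity), Real.inv_rpow hl₀.le, ← Real.rpow_natCast,
      ← Real.rpow_mul hl₀.le, ← Real.rpow_neg hl₀.le, ← Real.rpow_neg hl₀.le, ← Real.rpow_neg_one,
      ← Real.rpow_add hl₀, ← Real.rpow_add hl₀]
    exact Real.rpow_le_rpow_of_exponent_le hl (by push_cast; linarith)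
  calc (a * b * (l ^ 3)⁻¹) ^ r = a ^ r * (b ^ 2 * b ^ (r - 2)) * ((l ^ 3)⁻¹) ^ r := by
        rw [Real.mul_rpow (by positivity) (by positivity), Real.mul_rpow ha hb, split_rpow hb]
    _ ≤ (2 * κ) ^ r * (b ^ 2 * (Y * l) ^ (r - 2)) * ((l ^ 3)⁻¹) ^ r := by gcongr
    _ = 2 ^ r * (κ ^ 2 * κ ^ (r - 2)) * b ^ 2 * Y ^ (r - 2) *
          (l ^ (r - 2) * ((l ^ 3)⁻¹) ^ r) := by
        rw [Real.mul_rpow zero_le_two hκ.le, split_rpow hκ.le, Real.mul_rpow hY hl₀.le]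
        ring
    _ ≤ 2 ^ r * (κ ^ 2 * κ ^ (r - 2)) * b ^ 2 * Y ^ (r - 2) *
          (l⁻¹ * min 1 ((X / κ) ^ (2 * (r - 2)))) := by
        exact mul_le_mul_of_nonneg_left (damping.trans (by gcongr)) (by positivity)
    _ = _ := by ring

/-- The size of the coefficient `⟨f, φ⟩` of a function against an `L²`-normalized packet over `I`,
in the normalization in which it is an average of `f`. -/
noncomputable def coeff (I : DyadicInterval) (f φ : ℝ → ℂ) : ℝ := ‖pairing f φ‖ / √I.length

theorem coeff_nonneg (I : DyadicInterval) (f φ : ℝ → ℂ) : 0 ≤ coeff I f φ := by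
  unfold coeff; positivity

theorem length_mul_coeff_sq (I : DyadicInterval) (f φ : ℝ → ℂ) :
    I.length * coeff I f φ ^ 2 = ‖pairing f φ‖ ^ 2 := by
  rw [coeff, div_pow, Real.sq_sqrt I.length_pos.le, mul_div_cancel₀ _ I.length_pos.ne']

theorem IsRestricted.coeff_le {A F : Set ℝ} {δ D : ℝ} {f φ : ℝ → ℂ} {P : Tile}
    (hf : IsRestricted A δ F f) (hA : A.Nonempty) (hφ : IsPacket D P φ) :
    coeff P.space f φ ≤ 64 * D * min 1 δ * remoteness A P.space := by
  rw [coeff, div_le_iff₀ (Real.sqrt_pos.2 P.space.length_pos)]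
  exact (hf.norm_pairing_le hA (hφ.toIsBump.mono (by norm_num))).trans_eq (by ring)

/-- The product of the first two coefficients of `s`, damped by the remoteness of its spatial
interval. -/
noncomputable def dampedProduct {ι : Type*} (A : Set ℝ) (f g : ℝ → ℂ) (P : ι → Tile)
    (φ ψ : ι → ℝ → ℂ) (s : ι) : ℝ :=
  coeff (P s).space f (φ s) * coeff (P s).space g (ψ s) * (remoteness A (P s).space ^ 3)⁻¹

theorem dampedProduct_nonneg {ι : Type*} (A : Set ℝ) (f g : ℝ → ℂ) (P : ι → Tile)
    (φ ψ : ι → ℝ → ℂ) (s : ι) : 0 ≤ dampedProduct A f g P φ ψ s :=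
  mul_nonneg (mul_nonneg (coeff_nonneg ..) (coeff_nonneg ..))
    (inv_nonneg.2 (pow_nonneg (remoteness_pos ..).le 3))

/-- The constant of `IsBitileFamily.sum_length_mul_dampedProduct_le`. -/
noncomputable def dampedConst (r D : ℝ) : ℝ :=
  2 ^ 27 * 2 ^ r * dyadicSumConst (r - 2) * D ^ 4 * ((64 * D) ^ (r - 2)) ^ 2

theorem dampedConst_nonneg (r D : ℝ) : 0 ≤ dampedConst r D := by
  have := dyadicSumConst_nonneg (r - 2)
  unfold dampedConst
  positivity

namespace IsBitileFamily

variable {ι : Type*} {D r δ δ' : ℝ} {S : Finset ι} {P Q : ι → Tile} {φ ψ : ι → ℝ → ℂ}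
  {A F G : Set ℝ} {f g : ℝ → ℂ}

theorem sum_layer_le (h : IsBitileFamily D S P Q φ ψ) (hr : 2 < r) (hD : 0 ≤ D)
    (hA : A.Nonempty) (hf : IsRestricted A δ F f) (hg : IsRestricted A δ' G g) {κ : ℝ}
    (hκ : 0 < κ) (hlow : ∀ s ∈ S, κ ≤ coeff (P s).space f (φ s))
    (hup : ∀ s ∈ S, coeff (P s).space f (φ s) ≤ 2 * κ) :
    ∑ s ∈ S, (P s).space.length * dampedProduct A f g P φ ψ s ^ r ≤
      2 ^ 27 * 2 ^ r * D ^ 4 * volume.real F * min 1 δ' * (64 * D * min 1 δ') ^ (r - 2) *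
        (κ ^ (r - 2) * min 1 ((64 * D * min 1 δ / κ) ^ (2 * (r - 2)))) := by
  have hmin : 0 ≤ min 1 δ := le_min zero_le_one hf.nonneg
  have hmin' : 0 ≤ min 1 δ' := le_min zero_le_one hg.nonneg
  set Y := 64 * D * min 1 δ'
  set θ := κ ^ (r - 2) * min 1 ((64 * D * min 1 δ / κ) ^ (2 * (r - 2)))
  have hsqrt (s : ι) : 0 < √(P s).space.length := Real.sqrt_pos.2 (P s).space.length_pos
  have pointwise : ∀ s ∈ S, (P s).space.length * dampedProduct A f g P φ ψ s ^ r ≤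
      2 ^ r * Y ^ (r - 2) * θ *
        (κ ^ 2 * (‖pairing g (ψ s)‖ ^ 2 * (remoteness A (P s).space)⁻¹)) := by
    intro s hs
    have := (P s).space.length_pos
    calc (P s).space.length * dampedProduct A f g P φ ψ s ^ r
        ≤ (P s).space.length * (2 ^ r * Y ^ (r - 2) * θ *
          (κ ^ 2 * (coeff (P s).space g (ψ s) ^ 2 * (remoteness A (P s).space)⁻¹))) := by
          gcongr
          refine mul_damping_rpow_le hr (coeff_nonneg ..) (one_le_remoteness A _) hκ (hlow s hs)
            (hup s hs) (hf.coeff_le hA (h.fst s hs)) ?_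
          rw [h.space_eq s hs]
          exact hg.coeff_le hA (h.snd s hs)
      _ = _ := by rw [← length_mul_coeff_sq (P s).space]; ring
  calc ∑ s ∈ S, (P s).space.length * dampedProduct A f g P φ ψ s ^ r
      ≤ 2 ^ r * Y ^ (r - 2) * θ * (κ ^ 2 *
          ∑ s ∈ S, ‖pairing g (ψ s)‖ ^ 2 * (remoteness A (P s).space)⁻¹) := by
        simpa only [Finset.mul_sum] using Finset.sum_le_sum pointwise
    _ ≤ 2 ^ r * Y ^ (r - 2) * θ * (2 ^ 27 * D ^ 4 * volume.real F * min 1 δ') := by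
        refine mul_le_mul_of_nonneg_left ?_ (by positivity)
        exact h.sq_mul_sum_layer_le hA hf hg hκ.le
          (fun s hs => (le_div_iff₀ (hsqrt s)).1 (hlow s hs))
          (fun s hs => (div_le_iff₀ (hsqrt s)).1 (hup s hs))
    _ = _ := by ring

theorem sum_length_mul_dampedProduct_le (h : IsBitileFamily D S P Q φ ψ) (hr : 2 < r)
    (hD : 0 ≤ D) (hA : A.Nonempty) (hf : IsRestricted A δ F f) (hg : IsRestricted A δ' G g) :
    ∑ s ∈ S, (P s).space.length * dampedProduct A f g P φ ψ s ^ r ≤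
      dampedConst r D * (volume.real F * min 1 δ ^ (r - 2) * min 1 δ' ^ (r - 1)) := by
  classical
  have hmin : 0 ≤ min 1 δ := le_min zero_le_one hf.nonneg
  have hmin' : 0 ≤ min 1 δ' := le_min zero_le_one hg.nonneg
  let a : ι → ℝ := fun s => coeff (P s).space f (φ s)
  let n : ι → ℤ := fun s => Int.log 2 (a s)
  set T := {s ∈ S | 0 < a s}
  have zpow_le : ∀ s ∈ T, (2 : ℝ) ^ n s ≤ a s := fun s hs => by
    exact_mod_cast Int.zpow_log_le_self one_lt_two (Finset.mem_filter.1 hs).2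
  have le_zpow (s : ι) : a s ≤ 2 * (2 : ℝ) ^ n s := by
    rw [← zpow_one_add₀ two_ne_zero, add_comm]
    exact_mod_cast (Int.lt_zpow_succ_log_self one_lt_two (a s)).le
  set θ : ℤ → ℝ := fun k =>
    ((2 : ℝ) ^ k) ^ (r - 2) * min 1 ((64 * D * min 1 δ / 2 ^ k) ^ (2 * (r - 2)))
  set c := 2 ^ 27 * 2 ^ r * D ^ 4 * volume.real F * min 1 δ' * (64 * D * min 1 δ') ^ (r - 2)
  calc ∑ s ∈ S, (P s).space.length * dampedProduct A f g P φ ψ s ^ r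
      = ∑ s ∈ T, (P s).space.length * dampedProduct A f g P φ ψ s ^ r := by
        refine (Finset.sum_filter_of_ne fun s _ hne => ?_).symm
        refine (coeff_nonneg ..).lt_of_ne' fun h0 => hne ?_
        rw [dampedProduct, h0, zero_mul, zero_mul, Real.zero_rpow (by linarith), mul_zero]
    _ = ∑ k ∈ T.image n, ∑ s ∈ T with n s = k,
          (P s).space.length * dampedProduct A f g P φ ψ s ^ r :=
        (Finset.sum_fiberwise_of_maps_to (fun s hs => Finset.mem_image_of_mem n hs) _).symm
    _ ≤ ∑ k ∈ T.image n, c * θ k := by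
        refine Finset.sum_le_sum fun k _ => ?_
        have hsub : T.filter (n · = k) ⊆ T := Finset.filter_subset _ _
        refine (h.mono (hsub.trans (Finset.filter_subset _ S))).sum_layer_le hr hD hA hf hg
          (zpow_pos two_pos k) (fun s hs => ?_) (fun s hs => ?_) <;>
        rw [← (Finset.mem_filter.1 hs).2]
        exacts [zpow_le s (hsub hs), le_zpow s]
    _ ≤ c * (dyadicSumConst (r - 2) * (64 * D * min 1 δ) ^ (r - 2)) := by
        rw [← Finset.mul_sum]
        gcongr
        exact sum_zpow_rpow_mul_min_le (by linarith) (by positivity) _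
    _ = _ := by
        rw [dampedConst, show r - 1 = 1 + (r - 2) by ring,
          Real.rpow_add_of_nonneg hmin' zero_le_one (by linarith), Real.rpow_one]
        simp only [c]
        rw [Real.mul_rpow (by positivity) hmin, Real.mul_rpow (by positivity) hmin']
        ring

end IsBitileFamily

theorem lintegral_rpow_le_lintegral_rpow {α : Type*} [MeasurableSpace α] {μ : Measure α}
    {u : α → ℝ≥0∞} (hu : AEMeasurable u μ) {p : ℝ} (hp : 1 ≤ p) :
    (∫⁻ x, u x ∂μ) ^ p ≤ (∫⁻ x, u x ^ p ∂μ) * μ Set.univ ^ (p - 1) := by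
  have hp₀ : 0 < p := zero_lt_one.trans_le hp
  have jensen := eLpNorm'_le_eLpNorm'_mul_rpow_measure_univ one_pos hp hu.aestronglyMeasurable
  simp only [eLpNorm', enorm_eq_self, ENNReal.rpow_one, div_one] at jensen
  calc (∫⁻ x, u x ∂μ) ^ p
      ≤ ((∫⁻ x, u x ^ p ∂μ) ^ (1 / p) * μ Set.univ ^ (1 - 1 / p)) ^ p := by gcongr
    _ = _ := by
        rw [ENNReal.mul_rpow_of_nonneg _ _ hp₀.le, ← ENNReal.rpow_mul, ← ENNReal.rpow_mul,
          one_div_mul_cancel hp₀.ne', ENNReal.rpow_one, sub_mul, one_mul,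
          one_div_mul_cancel hp₀.ne']

theorem measurable_ofReal_inv_bracket_sq (I : DyadicInterval) :
    Measurable fun x => ENNReal.ofReal ((I.bracket x ^ 2)⁻¹) :=
  ENNReal.measurable_ofReal.comp (I.continuous_bracket.measurable.pow_const 2).inv

theorem lintegral_mul_inv_bracket_sq_rpow_le (I : DyadicInterval) {u : ℝ → ℝ≥0∞}
    (hu : AEMeasurable u) {p : ℝ} (hp : 1 ≤ p) :
    (∫⁻ x, u x * ENNReal.ofReal ((I.bracket x ^ 2)⁻¹)) ^ p ≤
      (∫⁻ x, u x ^ p * ENNReal.ofReal ((I.bracket x ^ 2)⁻¹)) *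
        ENNReal.ofReal (4 * I.length) ^ (p - 1) := by
  set w := fun x => ENNReal.ofReal ((I.bracket x ^ 2)⁻¹)
  have hw : AEMeasurable w := (measurable_ofReal_inv_bracket_sq I).aemeasurable
  have withDensity_eq {v : ℝ → ℝ≥0∞} (hv : AEMeasurable v) :
      ∫⁻ x, v x * w x = ∫⁻ x, v x ∂volume.withDensity w := by
    rw [lintegral_withDensity_eq_lintegral_mul₀ hw hv]
    simp only [Pi.mul_apply, mul_comm]
  rw [withDensity_eq hu, withDensity_eq (hu.pow_const p)]
  refine (lintegral_rpow_le_lintegral_rpow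
    (hu.mono_ac (withDensity_absolutelyContinuous _ _)) hp).trans ?_
  gcongr
  rw [withDensity_apply _ MeasurableSet.univ, setLIntegral_univ]
  exact lintegral_decay_le I.length_pos I.center

section vanishing

variable {A : Set ℝ} {D : ℝ} {I : DyadicInterval} {u φ : ℝ → ℂ}

theorem ofReal_coeff_mul_remoteness_le (hφ : IsBump 5 D I φ) (hu : ∀ᵐ x, x ∉ A → u x = 0) :
    ENNReal.ofReal (coeff I u φ * remoteness A I ^ 3) ≤
      ENNReal.ofReal (D * I.length⁻¹) *
        ∫⁻ x, ‖u x‖ₑ * ENNReal.ofReal ((I.bracket x ^ 2)⁻¹) := by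
  have hD := hφ.nonneg
  have hI := I.length_pos
  have hl := remoteness_pos A I
  have pointwise : ∀ᵐ x, ‖u x * starRingEnd ℂ (φ x)‖ₑ ≤
      ENNReal.ofReal (D * (√I.length)⁻¹ * (remoteness A I ^ 3)⁻¹) *
        (‖u x‖ₑ * ENNReal.ofReal ((I.bracket x ^ 2)⁻¹)) := by
    filter_upwards [hu] with x hx
    by_cases hxA : x ∈ A
    · rw [enorm_mul, RCLike.enorm_conj, mul_left_comm, ← ENNReal.ofReal_mul (by positivity),
        ← ofReal_norm (φ x)]
      gcongr
      refine (hφ.bound x).trans ?_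
      rw [mul_assoc (D * _), ← mul_inv]
      have hb := I.bracket_pos x
      gcongr
      calc remoteness A I ^ 3 * I.bracket x ^ 2 ≤ I.bracket x ^ 3 * I.bracket x ^ 2 := by
            gcongr
            exact remoteness_le_bracket hxA
        _ = I.bracket x ^ 5 := by ring
    · simp [hx hxA]
  calc ENNReal.ofReal (coeff I u φ * remoteness A I ^ 3)
      = ‖pairing u φ‖ₑ * ENNReal.ofReal ((√I.length)⁻¹ * remoteness A I ^ 3) := by
        rw [coeff, div_eq_mul_inv, mul_assoc, ENNReal.ofReal_mul (norm_nonneg _), ofReal_norm]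
    _ ≤ ENNReal.ofReal (D * (√I.length)⁻¹ * (remoteness A I ^ 3)⁻¹) *
          (∫⁻ x, ‖u x‖ₑ * ENNReal.ofReal ((I.bracket x ^ 2)⁻¹)) *
          ENNReal.ofReal ((√I.length)⁻¹ * remoteness A I ^ 3) := by
        rw [← lintegral_const_mul' _ _ ENNReal.ofReal_ne_top]
        gcongr
        exact (enorm_integral_le_lintegral_enorm _).trans (lintegral_mono_ae pointwise)
    _ = _ := by
        rw [mul_right_comm, ← ENNReal.ofReal_mul (by positivity)]
        congr 2
        nth_rewrite 3 [← Real.mul_self_sqrt hI.le]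
        field_simp

theorem ofReal_length_mul_coeff_rpow_le (hφ : IsBump 5 D I φ) (hu : ∀ᵐ x, x ∉ A → u x = 0)
    (hum : AEStronglyMeasurable u) {p : ℝ} (hp : 1 ≤ p) :
    ENNReal.ofReal (I.length * (coeff I u φ * remoteness A I ^ 3) ^ p) ≤
      ENNReal.ofReal (D ^ p * 4 ^ (p - 1)) *
        ∫⁻ x, ‖u x‖ₑ ^ p * ENNReal.ofReal ((I.bracket x ^ 2)⁻¹) := by
  have hD := hφ.nonneg
  have hI := I.length_pos
  have hp₀ : 0 ≤ p := zero_le_one.trans hp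
  have hcoeff := mul_nonneg (coeff_nonneg I u φ) (pow_pos (remoteness_pos A I) 3).le
  set J := ∫⁻ x, ‖u x‖ₑ ^ p * ENNReal.ofReal ((I.bracket x ^ 2)⁻¹)
  calc ENNReal.ofReal (I.length * (coeff I u φ * remoteness A I ^ 3) ^ p)
      = ENNReal.ofReal I.length * ENNReal.ofReal (coeff I u φ * remoteness A I ^ 3) ^ p := by
        rw [ENNReal.ofReal_mul hI.le, ENNReal.ofReal_rpow_of_nonneg hcoeff hp₀]
    _ ≤ ENNReal.ofReal I.length * (ENNReal.ofReal (D * I.length⁻¹) ^ p *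
          (J * ENNReal.ofReal (4 * I.length) ^ (p - 1))) := by
        gcongr
        refine (ENNReal.rpow_le_rpow (ofReal_coeff_mul_remoteness_le hφ hu) hp₀).trans ?_
        rw [ENNReal.mul_rpow_of_nonneg _ _ hp₀]
        gcongr
        exact lintegral_mul_inv_bracket_sq_rpow_le I hum.enorm hp
    _ = ENNReal.ofReal (I.length * ((D * I.length⁻¹) ^ p * (4 * I.length) ^ (p - 1))) * J := by
        rw [ENNReal.ofReal_rpow_of_nonneg (by positivity) hp₀,
          ENNReal.ofReal_rpow_of_nonneg (by positivity) (sub_nonneg.2 hp),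
          mul_comm J, ← mul_assoc, ← mul_assoc, ← ENNReal.ofReal_mul hI.le,
          ← ENNReal.ofReal_mul (by positivity), mul_assoc]
    _ = _ := by
        congr 2
        rw [Real.mul_rpow hD (by positivity), Real.mul_rpow (by norm_num) hI.le,
          Real.inv_rpow hI.le, Real.rpow_sub_one hI.ne']
        have : 0 < I.length ^ p := by positivity
        field_simp

end vanishing

theorem sum_inv_bracket_sq_le {ι : Type*} (s : Finset ι) (I : ι → DyadicInterval) {L : ℝ}
    (hL : ∀ i ∈ s, (I i).length = L) (hd : (s : Set ι).PairwiseDisjoint fun i => (I i).toSet)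
    (x : ℝ) : ∑ i ∈ s, ((I i).bracket x ^ 2)⁻¹ ≤ 16 := by
  rcases s.eq_empty_or_nonempty with rfl | ⟨i₀, hi₀⟩
  · simp
  have hL₀ : 0 < L := hL i₀ hi₀ ▸ (I i₀).length_pos
  refine le_of_mul_le_mul_left ?_ hL₀
  calc L * ∑ i ∈ s, ((I i).bracket x ^ 2)⁻¹
      = ∑ i ∈ s, (I i).length * ((1 + |(I i).center - x| / L) ^ 2)⁻¹ := by
        rw [Finset.mul_sum]
        refine Finset.sum_congr rfl fun i hi => ?_
        rw [DyadicInterval.bracket, hL i hi, abs_sub_comm]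
    _ ≤ 16 * L := sum_length_mul_decay_le s I hL₀ (fun i hi => (hL i hi).le) hd x
    _ = L * 16 := mul_comm _ _

section fibers

variable {ι Ω : Type*} {S : Finset ι} {I : ι → DyadicInterval} {Q : ι → Ω} {W : Set Ω}
  (hQ : ∀ s ∈ S, Q s ∈ W)
  (hd : ∀ s ∈ S, ∀ t ∈ S, s ≠ t → Q s = Q t →
    (I s).length = (I t).length ∧ Disjoint (I s).toSet (I t).toSet)

include hQ hd

theorem sum_mul_inv_bracket_sq_le (v : Ω → ℝ≥0∞) (x : ℝ) :
    ∑ s ∈ S, v (Q s) * ENNReal.ofReal (((I s).bracket x ^ 2)⁻¹) ≤ 16 * ∑' w : W, v w := by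
  classical
  have fiber : ∀ w ∈ S.image Q,
      ∑ s ∈ S with Q s = w, v (Q s) * ENNReal.ofReal (((I s).bracket x ^ 2)⁻¹) ≤ 16 * v w := by
    intro w hw
    obtain ⟨s₀, hs₀, rfl⟩ := Finset.mem_image.1 hw
    have brackets := sum_inv_bracket_sq_le {s ∈ S | Q s = Q s₀} I (L := (I s₀).length)
      (fun s hs => by
        obtain ⟨hs, hQs⟩ := Finset.mem_filter.1 hs
        by_cases heq : s = s₀
        exacts [heq ▸ rfl, (hd s hs s₀ hs₀ heq hQs).1])
      (fun s hs t ht hst => by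
        obtain ⟨hs, hQs⟩ := Finset.mem_filter.1 hs
        obtain ⟨ht, hQt⟩ := Finset.mem_filter.1 ht
        exact (hd s hs t ht hst (hQs.trans hQt.symm)).2) x
    calc ∑ s ∈ S with Q s = Q s₀, v (Q s) * ENNReal.ofReal (((I s).bracket x ^ 2)⁻¹)
        = ∑ s ∈ S with Q s = Q s₀, v (Q s₀) * ENNReal.ofReal (((I s).bracket x ^ 2)⁻¹) :=
          Finset.sum_congr rfl fun s hs => by rw [(Finset.mem_filter.1 hs).2]
      _ = ENNReal.ofReal (∑ s ∈ S with Q s = Q s₀, ((I s).bracket x ^ 2)⁻¹) * v (Q s₀) := by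
          rw [← Finset.mul_sum, ENNReal.ofReal_sum_of_nonneg fun s _ => by positivity, mul_comm]
      _ ≤ 16 * v (Q s₀) := by
          gcongr
          exact (ENNReal.ofReal_le_ofReal brackets).trans_eq (ENNReal.ofReal_ofNat 16)
  calc ∑ s ∈ S, v (Q s) * ENNReal.ofReal (((I s).bracket x ^ 2)⁻¹)
      = ∑ w ∈ S.image Q, ∑ s ∈ S with Q s = w,
          v (Q s) * ENNReal.ofReal (((I s).bracket x ^ 2)⁻¹) :=
        (Finset.sum_fiberwise_of_maps_to (fun s hs => Finset.mem_image_of_mem Q hs) _).symm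
    _ ≤ 16 * ∑ w ∈ S.image Q, v w := by
        rw [Finset.mul_sum]
        exact Finset.sum_le_sum fiber
    _ ≤ 16 * ∑' w : W, v w := by
        gcongr
        rw [tsum_subtype W v]
        refine le_trans (Finset.sum_le_sum fun w hw => ?_) (ENNReal.sum_le_tsum (S.image Q))
        obtain ⟨s, hs, rfl⟩ := Finset.mem_image.1 hw
        rw [Set.indicator_of_mem (hQ s hs)]

theorem sum_length_mul_coeff_remoteness_rpow_le {D p : ℝ} (hD : 0 ≤ D) (hp : 1 ≤ p)
    {φ : ι → ℝ → ℂ} (hφ : ∀ s ∈ S, IsBump 5 D (I s) (φ s)) {h : Ω → ℝ → ℂ}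
    (hm : ∀ w ∈ W, AEStronglyMeasurable (h w)) {A : Set ℝ} (hA : MeasurableSet A)
    (hAfin : volume A < ∞) (hh : ∀ᵐ x, ∑' w : W, ‖h w x‖ₑ ^ p ≤ A.indicator 1 x) :
    ∑ s ∈ S, (I s).length * (coeff (I s) (h (Q s)) (φ s) * remoteness A (I s) ^ 3) ^ p ≤
      16 * D ^ p * 4 ^ (p - 1) * volume.real A := by
  have vanishing : ∀ w ∈ W, ∀ᵐ x, x ∉ A → h w x = 0 := by
    intro w hw
    filter_upwards [hh] with x hx hxA
    rw [Set.indicator_of_notMem hxA] at hx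
    have hle := (ENNReal.le_tsum (f := fun w : W => ‖h w x‖ₑ ^ p) ⟨w, hw⟩).trans hx
    rwa [nonpos_iff_eq_zero, ENNReal.rpow_eq_zero_iff_of_pos (by linarith), enorm_eq_zero] at hle
  have total : ∑ s ∈ S, ∫⁻ x, ‖h (Q s) x‖ₑ ^ p * ENNReal.ofReal (((I s).bracket x ^ 2)⁻¹) ≤
      16 * volume A := by
    have measurable : ∀ s ∈ S, AEMeasurable fun x =>
        ‖h (Q s) x‖ₑ ^ p * ENNReal.ofReal (((I s).bracket x ^ 2)⁻¹) := fun s hs =>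
      ((hm _ (hQ s hs)).enorm.pow_const p).mul (measurable_ofReal_inv_bracket_sq _).aemeasurable
    rw [← lintegral_finsetSum' S measurable]
    calc ∫⁻ x, ∑ s ∈ S, ‖h (Q s) x‖ₑ ^ p * ENNReal.ofReal (((I s).bracket x ^ 2)⁻¹)
        ≤ ∫⁻ x, 16 * A.indicator 1 x := by
          refine lintegral_mono_ae ?_
          filter_upwards [hh] with x hx
          refine (sum_mul_inv_bracket_sq_le hQ hd (fun w => ‖h w x‖ₑ ^ p) x).trans ?_
          gcongr
      _ = 16 * volume A := by
          rw [lintegral_const_mul' _ _ (by norm_num), lintegral_indicator_one hA]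
  refine (ENNReal.ofReal_le_ofReal_iff (by positivity)).1 ?_
  rw [ENNReal.ofReal_sum_of_nonneg fun s _ => mul_nonneg (I s).length_pos.le <|
    Real.rpow_nonneg (mul_nonneg (coeff_nonneg ..) (pow_pos (remoteness_pos A _) 3).le) p]
  calc _ ≤ ∑ s ∈ S, ENNReal.ofReal (D ^ p * 4 ^ (p - 1)) *
          ∫⁻ x, ‖h (Q s) x‖ₑ ^ p * ENNReal.ofReal (((I s).bracket x ^ 2)⁻¹) :=
        Finset.sum_le_sum fun s hs => ofReal_length_mul_coeff_rpow_le (hφ s hs)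
          (vanishing _ (hQ s hs)) (hm _ (hQ s hs)) hp
    _ ≤ ENNReal.ofReal (D ^ p * 4 ^ (p - 1)) * (16 * volume A) := by
        rw [← Finset.mul_sum]
        gcongr
    _ = _ := by
        rw [← ofReal_measureReal hAfin.ne, ← ENNReal.ofReal_ofNat 16,
          ← ENNReal.ofReal_mul (by norm_num), ← ENNReal.ofReal_mul (by positivity)]
        congr 1; ring

end fibers

section interpolation

variable {r r' α β X Y : ℝ}

theorem rpow_sub_one_rpow_one_div_le (hrr' : r.HolderConjugate r') (hX : 0 ≤ X) (hX₁ : X ≤ 1)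
    (hα : α ≤ 1 / r') :
    (X ^ (r - 1)) ^ (1 / r) ≤ X ^ α := by
  have exponent : (r - 1) * (1 / r) = 1 / r' := by
    have := hrr'.inv_add_inv_eq_one
    rw [sub_mul, mul_one_div_cancel hrr'.pos.ne']
    simp only [one_div]
    linarith
  rw [← Real.rpow_mul hX, exponent]
  rcases hX.eq_or_lt with rfl | hX₀
  · rw [Real.zero_rpow (one_div_pos.2 hrr'.symm.pos).ne']
    exact Real.rpow_nonneg le_rfl α
  · exact Real.rpow_le_rpow_of_exponent_ge hX₀ hX₁ hα

theorem mul_min_rpow_rpow_one_div_le (hr : 2 < r) (hrr' : r.HolderConjugate r') (hX : 0 ≤ X)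
    (hXY : X ≤ Y) (hα : α ≤ 1 / r') (hβ₀ : 0 ≤ β) (hβ : β ≤ 1 / r') (hαβ : 1 / r ≤ α + β) :
    (X * min 1 X ^ (r - 2) * min 1 Y ^ (r - 1)) ^ (1 / r) ≤ X ^ α * Y ^ β := by
  have hY := hX.trans hXY
  have hmul : X * X ^ (r - 2) = X ^ (r - 1) := by
    rw [show r - 1 = 1 + (r - 2) by ring,
      Real.rpow_add_of_nonneg hX zero_le_one (sub_nonneg.2 hr.le), Real.rpow_one]
  have small {Z γ : ℝ} (hZ : 0 ≤ Z) (hZ₁ : Z ≤ 1) (hγ : γ ≤ 1 / r') :=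
    rpow_sub_one_rpow_one_div_le hrr' hZ hZ₁ hγ
  rcases le_total Y 1 with hY₁ | hY₁
  · rw [min_eq_right hY₁, min_eq_right (hXY.trans hY₁), hmul,
      Real.mul_rpow (by positivity) (by positivity)]
    gcongr
    exacts [small hX (hXY.trans hY₁) hα, small hY hY₁ hβ]
  rw [min_eq_left hY₁, Real.one_rpow, mul_one]
  rcases le_total X 1 with hX₁ | hX₁
  · rw [min_eq_right hX₁, hmul]
    exact (small hX hX₁ hα).trans
      (le_mul_of_one_le_right (Real.rpow_nonneg hX α) (Real.one_le_rpow hY₁ hβ₀))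
  · rw [min_eq_left hX₁, Real.one_rpow, mul_one]
    calc X ^ (1 / r) ≤ X ^ (α + β) := Real.rpow_le_rpow_of_exponent_le hX₁ hαβ
      _ = X ^ α * X ^ β := Real.rpow_add (by linarith) _ _
      _ ≤ X ^ α * Y ^ β := by gcongr

end interpolation

namespace IsBitileFamily

variable {ι : Type*} {D r r' α β X Y v : ℝ} {S : Finset ι} {P Q : ι → Tile} {φ ψ : ι → ℝ → ℂ}
  {A F G : Set ℝ} {f g : ℝ → ℂ}

theorem dampedProduct_swap (h : IsBitileFamily D S P Q φ ψ) {s : ι} (hs : s ∈ S) :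
    dampedProduct A g f Q ψ φ s = dampedProduct A f g P φ ψ s := by
  rw [dampedProduct, dampedProduct, ← h.space_eq s hs, mul_comm (coeff _ g _)]

theorem rpow_sum_dampedProduct_le_of_le (h : IsBitileFamily D S P Q φ ψ) (hr : 2 < r)
    (hrr' : r.HolderConjugate r') (hD : 0 ≤ D) (hA : A.Nonempty) (hf : IsRestricted A X F f)
    (hg : IsRestricted A Y G g) (hF : volume.real F ≤ v * X) (hv : 0 ≤ v) (hXY : X ≤ Y)
    (hα : α ≤ 1 / r') (hβ₀ : 0 ≤ β) (hβ : β ≤ 1 / r') (hαβ : 1 / r ≤ α + β) :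
    (∑ s ∈ S, (P s).space.length * dampedProduct A f g P φ ψ s ^ r) ^ (1 / r) ≤
      (dampedConst r D * v) ^ (1 / r) * (X ^ α * Y ^ β) := by
  have hr₀ : 0 < 1 / r := one_div_pos.2 hrr'.pos
  have hX := hf.nonneg
  have hminY : 0 ≤ min 1 Y := le_min zero_le_one hg.nonneg
  have hconst := dampedConst_nonneg r D
  calc (∑ s ∈ S, (P s).space.length * dampedProduct A f g P φ ψ s ^ r) ^ (1 / r)
      ≤ (dampedConst r D * (v * X * min 1 X ^ (r - 2) * min 1 Y ^ (r - 1))) ^ (1 / r) := by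
        refine Real.rpow_le_rpow (Finset.sum_nonneg fun s _ => mul_nonneg
          (P s).space.length_pos.le (Real.rpow_nonneg (dampedProduct_nonneg ..) r)) ?_ hr₀.le
        refine (h.sum_length_mul_dampedProduct_le hr hD hA hf hg).trans ?_
        gcongr
    _ = (dampedConst r D * v) ^ (1 / r) *
          (X * min 1 X ^ (r - 2) * min 1 Y ^ (r - 1)) ^ (1 / r) := by
        rw [← Real.mul_rpow (by positivity) (by positivity)]
        congr 1; ring
    _ ≤ _ := by
        gcongr
        exact mul_min_rpow_rpow_one_div_le hr hrr' hX hXY hα hβ₀ hβ hαβ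

theorem rpow_sum_dampedProduct_le (h : IsBitileFamily D S P Q φ ψ) (hr : 2 < r)
    (hrr' : r.HolderConjugate r') (hD : 0 ≤ D) (hA : A.Nonempty) (hf : IsRestricted A X F f)
    (hg : IsRestricted A Y G g) (hF : volume.real F ≤ v * X) (hG : volume.real G ≤ v * Y)
    (hv : 0 ≤ v) (hα₀ : 0 ≤ α) (hα : α ≤ 1 / r') (hβ₀ : 0 ≤ β) (hβ : β ≤ 1 / r')
    (hαβ : 1 / r ≤ α + β) :
    (∑ s ∈ S, (P s).space.length * dampedProduct A f g P φ ψ s ^ r) ^ (1 / r) ≤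
      (dampedConst r D * v) ^ (1 / r) * (X ^ α * Y ^ β) := by
  rcases le_total X Y with hXY | hYX
  · exact h.rpow_sum_dampedProduct_le_of_le hr hrr' hD hA hf hg hF hv hXY hα hβ₀ hβ hαβ
  · rw [Finset.sum_congr rfl fun s hs => by rw [h.space_eq s hs, ← h.dampedProduct_swap hs],
      mul_comm (X ^ α)]
    exact h.swap.rpow_sum_dampedProduct_le_of_le hr hrr' hD hA hg hf hG hv hYX hβ hα₀ hα
      (hαβ.trans_eq (add_comm α β))

end IsBitileFamily

section packets

variable {a C θ : ℝ} {I : DyadicInterval} {φ : ℝ → ℂ}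
  (h : IsAdapted C 1 I fun x => (√I.length : ℂ) * modulate θ φ x)

include h

theorem IsAdapted.continuous_of_modulate : Continuous φ := by
  have hsqrt : (√I.length : ℂ) ≠ 0 := by exact_mod_cast (Real.sqrt_pos.2 I.length_pos).ne'
  have demodulate : φ = fun x : ℝ => (√I.length : ℂ)⁻¹ *
      Complex.exp (-(2 * Real.pi * Complex.I * θ * x)) * ((√I.length : ℂ) * modulate θ φ x) := by
    funext x
    have := Complex.exp_ne_zero (2 * Real.pi * Complex.I * θ * x)
    rw [modulate, Complex.exp_neg]
    field_simp
  rw [demodulate]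
  exact Continuous.mul (by fun_prop) h.1.continuous

theorem IsAdapted.isBump : IsBump 5 (2 ^ 10 * |C|) I φ := by
  refine IsBump.mono (n := 10) ⟨h.continuous_of_modulate, fun x => ?_⟩ (by norm_num)
  have hsqrt := Real.sqrt_pos.2 I.length_pos
  have norm_modulate : ‖modulate θ φ x‖ = ‖φ x‖ := by
    rw [modulate, norm_mul, show 2 * (Real.pi : ℂ) * Complex.I * θ * x =
      (2 * Real.pi * θ * x : ℝ) * Complex.I by push_cast; ring, Complex.norm_exp_ofReal_mul_I,
      one_mul]
  have adapted := h.2 0 (Nat.zero_le 1) x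
  rw [iteratedDeriv_zero, norm_mul, Complex.norm_real, Real.norm_of_nonneg hsqrt.le,
    norm_modulate, pow_zero, inv_one, mul_one, pow_one] at adapted
  have hchi : 0 ≤ I.chi x := zpow_nonneg (add_nonneg zero_le_one
    (div_nonneg Metric.infDist_nonneg I.length_pos.le)) _
  calc ‖φ x‖ = (√I.length)⁻¹ * (√I.length * ‖φ x‖) := by field_simp
    _ ≤ (√I.length)⁻¹ * (|C| * (2 ^ 10 * (I.bracket x ^ 10)⁻¹)) := by
        refine mul_le_mul_of_nonneg_left (adapted.trans ?_) (inv_pos.2 hsqrt).le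
        exact mul_le_mul (le_abs_self C) (I.chi_le x) hchi (abs_nonneg C)
    _ = _ := by ring

end packets

theorem IsWavePacket.isPacket {C : ℝ} {P : Tile} {φ : ℝ → ℂ} (h : IsWavePacket 1 C 1 P φ) :
    IsPacket (2 ^ 10 * |C|) P φ :=
  ⟨h.1.isBump, h.2.2⟩

namespace Tritile

variable {s t : Tritile}

/-- The position of the third frequency interval of a tri-tile relative to the sum of the first two,
in units of their common length. -/
def thirdOffset (s : Tritile) : ℤ := (s.freq 2).pos - (s.freq 0).pos - (s.freq 1).pos

theorem freq_length (s : Tritile) (j : Fin 3) : (s.freq j).length = s.space.length⁻¹ :=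
  (s.tile j).freq_length

theorem thirdOffset_mem_Icc {B : ℝ} (h : s.ThirdComparable B) :
    s.thirdOffset ∈ Finset.Icc ⌈1 / 2 - B⌉ ⌊1 / 2 + B⌋ := by
  have hL := s.space.length_pos
  have distance_le : |(s.thirdOffset : ℝ) - 1 / 2| ≤ B := by
    refine le_of_mul_le_mul_right (le_trans (le_of_eq ?_) h) (s.freq 0).length_pos
    simp only [DyadicInterval.center, s.freq_length]
    rw [← abs_of_pos (inv_pos.2 hL), ← abs_mul, abs_of_pos (inv_pos.2 hL), thirdOffset]
    push_cast
    congr 1; ring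
  rw [abs_le] at distance_le
  rw [Finset.mem_Icc, Int.ceil_le, Int.le_floor]
  constructor <;> linarith

theorem eq_of_thirdOffset_eq (hI : s.space = t.space) (hsq : s.square = t.square)
    (ho : s.thirdOffset = t.thirdOffset) : s = t := by
  have h0 : s.freq 0 = t.freq 0 := congrArg DyadicSquare.fst hsq
  have h1 : s.freq 1 = t.freq 1 := congrArg DyadicSquare.snd hsq
  have hscale : (s.freq 2).scale = (t.freq 2).scale := by
    rw [← DyadicInterval.length_eq_iff, s.freq_length, t.freq_length, hI]
  have hpos : (s.freq 2).pos = (t.freq 2).pos := by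
    rw [thirdOffset, thirdOffset, h0, h1] at ho
    linarith
  have h2 : s.freq 2 = t.freq 2 := by
    cases hs : s.freq 2
    cases ht : t.freq 2
    simp_all only
  have hfreq : s.freq = t.freq := by
    funext j
    fin_cases j
    exacts [h0, h1, h2]
  cases s; cases t
  simp_all only

theorem disjoint_space (hst : s ≠ t) (hsq : s.square = t.square)
    (ho : s.thirdOffset = t.thirdOffset) :
    s.space.length = t.space.length ∧ Disjoint s.space.toSet t.space.toSet := by
  have hl : s.space.length = t.space.length := by
    have h0 : (s.freq 0).length = (t.freq 0).length :=
      congrArg (fun w : DyadicSquare => w.fst.length) hsq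
    rwa [s.freq_length, t.freq_length, inv_inj] at h0
  refine ⟨hl, ?_⟩
  by_contra hd
  exact hst (eq_of_thirdOffset_eq (DyadicInterval.eq_of_not_disjoint hl hd) hsq ho)

end Tritile

theorem sum_weight_mul_le_Lp_mul_Lq {ι : Type*} (S : Finset ι) {w a b : ι → ℝ} {p q : ℝ}
    (hpq : p.HolderConjugate q) (hw : ∀ s ∈ S, 0 ≤ w s) (ha : ∀ s ∈ S, 0 ≤ a s)
    (hb : ∀ s ∈ S, 0 ≤ b s) :
    ∑ s ∈ S, w s * (a s * b s) ≤
      (∑ s ∈ S, w s * a s ^ p) ^ (1 / p) * (∑ s ∈ S, w s * b s ^ q) ^ (1 / q) := by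
  have rpow_eq {e z : ℝ} {s : ι} (hs : s ∈ S) (he : 0 < e) (hz : 0 ≤ z) :
      w s * z ^ e = (w s ^ (1 / e) * z) ^ e := by
    rw [Real.mul_rpow (Real.rpow_nonneg (hw s hs) _) hz, ← Real.rpow_mul (hw s hs),
      one_div_mul_cancel he.ne', Real.rpow_one]
  rw [Finset.sum_congr rfl fun s hs => rpow_eq hs hpq.pos (ha s hs),
    Finset.sum_congr rfl fun s hs => rpow_eq hs hpq.symm.pos (hb s hs)]
  calc ∑ s ∈ S, w s * (a s * b s)
      = ∑ s ∈ S, w s ^ (1 / p) * a s * (w s ^ (1 / q) * b s) := by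
        refine Finset.sum_congr rfl fun s hs => ?_
        rw [mul_mul_mul_comm, ← Real.rpow_add_of_nonneg (hw s hs) (one_div_pos.2 hpq.pos).le
          (one_div_pos.2 hpq.symm.pos).le, one_div, one_div, hpq.inv_add_inv_eq_one,
          Real.rpow_one]
    _ ≤ _ := Real.inner_le_Lp_mul_Lq_of_nonneg S hpq
        (fun s hs => mul_nonneg (Real.rpow_nonneg (hw s hs) _) (ha s hs))
        (fun s hs => mul_nonneg (Real.rpow_nonneg (hw s hs) _) (hb s hs))

theorem norm_modelForm_le_sum (A : Set ℝ) (S : Finset Tritile) (φ : Tritile → Fin 3 → ℝ → ℂ)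
    (f g : ℝ → ℂ) (h : DyadicSquare → ℝ → ℂ) :
    ‖modelForm S φ f g h‖ ≤ ∑ s ∈ S, s.space.length *
      (dampedProduct A f g (fun s : Tritile => s.tile 0) (φ · 0) (φ · 1) s *
        (coeff s.space (h s.square) (φ s 2) * remoteness A s.space ^ 3)) := by
  refine (norm_sum_le _ _).trans_eq (Finset.sum_congr rfl fun s _ => ?_)
  have hI := s.space.length_pos
  have hrem := remoteness_pos A s.space
  have weight : s.space.length ^ (-(1 / 2) : ℝ) = (√s.space.length)⁻¹ := by
    rw [Real.rpow_neg hI.le, Real.sqrt_eq_rpow]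
  rw [norm_mul, norm_mul, norm_mul, Complex.norm_real, Real.norm_of_nonneg (by positivity),
    weight]
  simp only [dampedProduct, coeff, Tritile.tile]
  nth_rewrite 2 [← Real.mul_self_sqrt hI.le]
  field_simp

/-- The constant in the estimate for the tri-tiles with a fixed offset, all of whose wave packets
are bumps with constant `D`. -/
noncomputable def offsetConst (r r' D : ℝ) : ℝ :=
  dampedConst r D ^ (1 / r) * (16 * D ^ r' * 4 ^ (r' - 1)) ^ (1 / r')

theorem offsetConst_nonneg {D : ℝ} (hD : 0 ≤ D) (r r' : ℝ) : 0 ≤ offsetConst r r' D := by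
  have := dampedConst_nonneg r D
  unfold offsetConst
  positivity

namespace IsModel

variable {B C r r' α β X Y v : ℝ} {N : ℕ} {W : Set DyadicSquare} {S : Finset Tritile}
  {φ : Tritile → Fin 3 → ℝ → ℂ} {A F G : Set ℝ} {f g : ℝ → ℂ} {h : DyadicSquare → ℝ → ℂ}

theorem mono (hmod : IsModel B C N W S φ) {T : Finset Tritile} (hT : T ⊆ S) :
    IsModel B C N W T φ where
  disjoint := hmod.disjoint
  square_mem s hs := hmod.square_mem s (hT hs)
  third s hs := hmod.third s (hT hs)
  packet s hs := hmod.packet s (hT hs)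

theorem isBitileFamily (hmod : IsModel B C 1 W S φ) {d : ℤ} (hd : ∀ s ∈ S, s.thirdOffset = d) :
    IsBitileFamily (2 ^ 10 * |C|) S (fun s => s.tile 0) (fun s => s.tile 1) (φ · 0) (φ · 1) where
  space_eq _ _ := rfl
  fst s hs := (hmod.packet s hs 0).isPacket
  snd s hs := (hmod.packet s hs 1).isPacket
  disjoint s hs t ht hst := by
    by_cases hsq : s.square = t.square
    · exact .inr (.inr ⟨congrArg DyadicSquare.fst hsq, congrArg DyadicSquare.snd hsq,
        (Tritile.disjoint_space hst hsq ((hd s hs).trans (hd t ht).symm)).2⟩)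
    · rcases Set.disjoint_prod.1
        (hmod.disjoint (hmod.square_mem s hs) (hmod.square_mem t ht) hsq) with hfst | hsnd
      exacts [.inl hfst, .inr (.inl hsnd)]

variable (hmod : IsModel B C 1 W S φ) (hr : 2 < r) (hrr' : r.HolderConjugate r')
  (hA : MeasurableSet A) (hA₀ : A.Nonempty) (hAfin : volume A < ∞) (hAv : volume.real A ≤ v)
  (hf : IsRestricted A X F f) (hg : IsRestricted A Y G g) (hF : volume.real F ≤ v * X)
  (hG : volume.real G ≤ v * Y) (hm : ∀ w ∈ W, AEStronglyMeasurable (h w))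
  (hh : ∀ᵐ x, ∑' w : W, ‖h w x‖ₑ ^ r' ≤ A.indicator 1 x)
  (hα₀ : 0 ≤ α) (hα : α ≤ 1 / r') (hβ₀ : 0 ≤ β) (hβ : β ≤ 1 / r') (hαβ : 1 / r ≤ α + β)

include hmod hr hrr' hA hA₀ hAfin hAv hf hg hF hG hm hh hα₀ hα hβ₀ hβ hαβ

theorem norm_modelForm_le_of_thirdOffset_eq {d : ℤ} (hd : ∀ s ∈ S, s.thirdOffset = d) :
    ‖modelForm S φ f g h‖ ≤ offsetConst r r' (2 ^ 10 * |C|) * (v * (X ^ α * Y ^ β)) := by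
  set D := 2 ^ 10 * |C|
  have hD : 0 ≤ D := by positivity
  have hv : 0 ≤ v := measureReal_nonneg.trans hAv
  have hconst := dampedConst_nonneg r D
  have hlength (s : Tritile) := s.space.length_pos.le
  have third_nonneg (s : Tritile) :
      0 ≤ coeff s.space (h s.square) (φ s 2) * remoteness A s.space ^ 3 :=
    mul_nonneg (coeff_nonneg ..) (pow_nonneg (remoteness_pos ..).le 3)
  have pair := (hmod.isBitileFamily hd).rpow_sum_dampedProduct_le hr hrr' hD hA₀ hf hg hF hG hv
    hα₀ hα hβ₀ hβ hαβ
  have third := sum_length_mul_coeff_remoteness_rpow_le (I := Tritile.space) hmod.square_mem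
    (fun s hs t ht hst hsq => Tritile.disjoint_space hst hsq ((hd s hs).trans (hd t ht).symm))
    hD hrr'.symm.lt.le (fun s hs => (hmod.packet s hs 2).1.isBump) hm hA hAfin hh
  calc ‖modelForm S φ f g h‖
      ≤ _ := norm_modelForm_le_sum A S φ f g h
    _ ≤ _ := sum_weight_mul_le_Lp_mul_Lq S hrr' (fun s _ => hlength s)
        (fun s _ => dampedProduct_nonneg ..) (fun s _ => third_nonneg s)
    _ ≤ (dampedConst r D * v) ^ (1 / r) * (X ^ α * Y ^ β) *
          (16 * D ^ r' * 4 ^ (r' - 1) * v) ^ (1 / r') := by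
        have hX := hf.nonneg
        have hY := hg.nonneg
        refine mul_le_mul pair (Real.rpow_le_rpow (Finset.sum_nonneg fun s _ => mul_nonneg
          (hlength s) (Real.rpow_nonneg (third_nonneg s) _)) (third.trans ?_)
          (one_div_pos.2 hrr'.symm.pos).le) (Real.rpow_nonneg (Finset.sum_nonneg fun s _ =>
            mul_nonneg (hlength s) (Real.rpow_nonneg (third_nonneg s) _)) _) (by positivity)
        gcongr
    _ = offsetConst r r' D * (v ^ (1 / r) * v ^ (1 / r') * (X ^ α * Y ^ β)) := by
        rw [offsetConst, Real.mul_rpow hconst hv, Real.mul_rpow (by positivity) hv]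
        ring
    _ = _ := by
        rw [← Real.rpow_add_of_nonneg hv (one_div_pos.2 hrr'.pos).le
          (one_div_pos.2 hrr'.symm.pos).le, one_div, one_div, hrr'.inv_add_inv_eq_one,
          Real.rpow_one]

theorem norm_modelForm_le : ‖modelForm S φ f g h‖ ≤ (Finset.Icc ⌈1 / 2 - B⌉ ⌊1 / 2 + B⌋).card *
    (offsetConst r r' (2 ^ 10 * |C|) * (v * (X ^ α * Y ^ β))) := by
  have split : modelForm S φ f g h = ∑ d ∈ Finset.Icc ⌈1 / 2 - B⌉ ⌊1 / 2 + B⌋,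
      modelForm {s ∈ S | s.thirdOffset = d} φ f g h :=
    (Finset.sum_fiberwise_of_maps_to
      (fun s hs => Tritile.thirdOffset_mem_Icc (hmod.third s hs)) _).symm
  rw [split, ← nsmul_eq_mul, ← Finset.sum_const]
  exact norm_sum_le_of_le _ fun d _ =>
    (hmod.mono (Finset.filter_subset _ S)).norm_modelForm_le_of_thirdOffset_eq hr hrr' hA hA₀
      hAfin hAv hf hg hF hG hm hh hα₀ hα hβ₀ hβ hαβ fun s hs => (Finset.mem_filter.1 hs).2

end IsModel

theorem volume_denseSet_le (μ : Measure ℝ) [IsFiniteMeasure μ] {v : ℝ} (hv : 0 < v) :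
    volume (denseSet μ (25 * μ.real Set.univ / v)) ≤ ENNReal.ofReal (v / 5) := by
  rcases eq_or_ne μ 0 with rfl | hμ
  · simp [denseSet]
  have : NeZero μ := ⟨hμ⟩
  set m := μ.real Set.univ
  have hm₀ : 0 < m := measureReal_univ_pos
  have weak := volume_denseSet_mul_le μ (show 0 < 25 * m / v by positivity)
  calc volume (denseSet μ (25 * m / v))
      ≤ 5 * μ Set.univ / ENNReal.ofReal (25 * m / v) :=
        (ENNReal.le_div_iff_mul_le (.inl (ENNReal.ofReal_pos.2 (by positivity)).ne')
          (.inl ENNReal.ofReal_ne_top)).2 weak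
    _ = ENNReal.ofReal (5 * m / (25 * m / v)) := by
        rw [← ofReal_measureReal (μ := μ), ← ENNReal.ofReal_ofNat 5,
          ← ENNReal.ofReal_mul (by norm_num), ← ENNReal.ofReal_div_of_pos (by positivity)]
    _ = ENNReal.ofReal (v / 5) := by
        congr 1
        field_simp
        norm_num

theorem exists_large_subset_notMem_denseSet (μ ν : Measure ℝ) [IsFiniteMeasure μ]
    [IsFiniteMeasure ν] {H : Set ℝ} (hH : MeasurableSet H) (hH₀ : 0 < volume H)
    (hHfin : volume H < ∞) :
    ∃ H', MeasurableSet H' ∧ H' ⊆ H ∧ volume H / 2 < volume H' ∧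
      (∀ x ∈ H', x ∉ denseSet μ (25 * μ.real Set.univ / volume.real H)) ∧
      ∀ x ∈ H', x ∉ denseSet ν (25 * ν.real Set.univ / volume.real H) := by
  have hv : 0 < volume.real H := ENNReal.toReal_pos hH₀.ne' hHfin.ne
  set E := denseSet μ (25 * μ.real Set.univ / volume.real H) ∪
    denseSet ν (25 * ν.real Set.univ / volume.real H)
  have hE : volume (toMeasurable volume E) ≤ ENNReal.ofReal (2 / 5 * volume.real H) := by
    rw [measure_toMeasurable, show 2 / 5 * volume.real H = volume.real H / 5 + volume.real H / 5 by
      ring, ENNReal.ofReal_add (by positivity) (by positivity)]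
    exact (measure_union_le _ _).trans
      (add_le_add (volume_denseSet_le μ hv) (volume_denseSet_le ν hv))
  have large : volume H / 2 < volume (H \ toMeasurable volume E) := by
    refine lt_of_lt_of_le (lt_tsub_iff_right.2 ?_) le_measure_sdiff
    calc volume H / 2 + volume (toMeasurable volume E)
        ≤ ENNReal.ofReal (volume.real H / 2 + 2 / 5 * volume.real H) := by
          rw [ENNReal.ofReal_add (by positivity) (by positivity),
            ENNReal.ofReal_div_of_pos two_pos, ofReal_measureReal hHfin.ne, ENNReal.ofReal_ofNat]
          gcongr
      _ < ENNReal.ofReal (volume.real H) := (ENNReal.ofReal_lt_ofReal_iff hv).2 (by linarith)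
      _ = volume H := ofReal_measureReal hHfin.ne
  have notMem : ∀ x ∈ H \ toMeasurable volume E, x ∉ E := fun x hx hxE =>
    hx.2 (subset_toMeasurable volume E hxE)
  exact ⟨H \ toMeasurable volume E, hH.diff (measurableSet_toMeasurable _ _), Set.sdiff_subset,
    large, fun x hx hxE => notMem x hx (.inl hxE), fun x hx hxE => notMem x hx (.inr hxE)⟩

theorem le_indicator_one_of_rpow_le {α : Type*} {A : Set α} {u : ℝ≥0∞} {p : ℝ} (hp : 0 < p)
    {x : α} (h : u ^ (1 / p) ≤ A.indicator 1 x) : u ≤ A.indicator 1 x := by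
  rw [one_div, ENNReal.rpow_inv_le_iff hp] at h
  refine h.trans_eq ?_
  by_cases hx : x ∈ A <;> simp [hx, hp]

theorem mul_rpow_mul_rpow_le {x y v α β : ℝ} (hx : 0 ≤ x) (hy : 0 ≤ y) (hv : 0 < v) (hα : α ≤ 1)
    (hβ : β ≤ 1) :
    v * ((25 * x / v) ^ α * (25 * y / v) ^ β) ≤ 25 ^ 2 * (x ^ α * y ^ β * v ^ (1 - (α + β))) := by
  calc v * ((25 * x / v) ^ α * (25 * y / v) ^ β)
      = 25 ^ (α + β) * (x ^ α * y ^ β * v ^ (1 - (α + β))) := by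
        rw [Real.div_rpow (by positivity) hv.le, Real.div_rpow (by positivity) hv.le,
          Real.mul_rpow (by norm_num) hx, Real.mul_rpow (by norm_num) hy, Real.rpow_sub hv,
          Real.rpow_add hv, Real.rpow_add (by norm_num), Real.rpow_one]
        field_simp
    _ ≤ 25 ^ 2 * (x ^ α * y ^ β * v ^ (1 - (α + β))) := by
        rw [← Real.rpow_natCast 25 2]
        gcongr
        · norm_num
        · push_cast; linarith

end BilinearRdF

open BilinearRdF in
theorem proposition1p3_general (r r' : ℝ) (hr : 2 < r) (hrr' : r.HolderConjugate r') :
    ∃ K : ℝ → ℝ → ℝ,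
      ∀ F G H : Set ℝ, MeasurableSet F → MeasurableSet G → MeasurableSet H →
        volume F < ∞ → volume G < ∞ → 0 < volume H → volume H < ∞ →
        ∃ H' : Set ℝ, MeasurableSet H' ∧ H' ⊆ H ∧ volume H / 2 < volume H' ∧
          ∀ α β : ℝ, 0 ≤ α → α ≤ 1 / r' → 0 ≤ β → β ≤ 1 / r' → 1 / r ≤ α + β →
          ∀ (B C : ℝ) (W : Set DyadicSquare) (S : Finset Tritile)
            (φ : Tritile → Fin 3 → ℝ → ℂ),
            IsModel B C 1 W S φ →
          ∀ (f g : ℝ → ℂ) (h : DyadicSquare → ℝ → ℂ),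
            AEStronglyMeasurable f volume → AEStronglyMeasurable g volume →
            (∀ w ∈ W, AEStronglyMeasurable (h w) volume) →
            (∀ᵐ x, ‖f x‖ ≤ F.indicator 1 x) → (∀ᵐ x, ‖g x‖ ≤ G.indicator 1 x) →
            (∀ᵐ x, (∑' w : W, ‖h w x‖ₑ ^ r') ^ (1 / r') ≤ H'.indicator 1 x) →
            ‖modelForm S φ f g h‖ ≤
              K B C * (volume.real F ^ α * volume.real G ^ β *
                volume.real H ^ (1 - (α + β))) := by
  refine ⟨fun B C => (Finset.Icc ⌈1 / 2 - B⌉ ⌊1 / 2 + B⌋).card *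
    offsetConst r r' (2 ^ 10 * |C|) * 25 ^ 2, fun F G H hF hG hH hFfin hGfin hH₀ hHfin => ?_⟩
  have : IsFiniteMeasure (volume.restrict F) := isFiniteMeasure_restrict.2 hFfin.ne
  have : IsFiniteMeasure (volume.restrict G) := isFiniteMeasure_restrict.2 hGfin.ne
  obtain ⟨H', hH', hsub, hlarge, hFH', hGH'⟩ := exists_large_subset_notMem_denseSet
    (volume.restrict F) (volume.restrict G) hH hH₀ hHfin
  simp only [measureReal_restrict_apply_univ] at hFH' hGH'
  refine ⟨H', hH', hsub, hlarge, ?_⟩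
  intro α β hα₀ hα hβ₀ hβ hαβ B C W S φ hmod f g h hfm hgm hhm hf hg hh
  have hv : 0 < volume.real H := ENNReal.toReal_pos hH₀.ne' hHfin.ne
  have hr' : 1 / r' ≤ 1 := (div_le_one hrr'.symm.pos).2 hrr'.symm.lt.le
  have density (E : Set ℝ) :
      volume.real E ≤ volume.real H * (25 * volume.real E / volume.real H) := by
    rw [mul_div_cancel₀ _ hv.ne']
    linarith [measureReal_nonneg (μ := volume) (s := E)]
  refine (hmod.norm_modelForm_le hr hrr' hH' (nonempty_of_measure_ne_zero hlarge.ne_bot)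
    ((measure_mono hsub).trans_lt hHfin) (measureReal_mono hsub hHfin.ne)
    ⟨hF, hFfin, by positivity, hFH', hfm, hf⟩ ⟨hG, hGfin, by positivity, hGH', hgm, hg⟩
    (density F) (density G) hhm (hh.mono fun x => le_indicator_one_of_rpow_le hrr'.symm.pos)
    hα₀ hα hβ₀ hβ hαβ).trans ?_
  rw [← mul_assoc, mul_assoc _ (25 ^ 2 : ℝ)]
  exact mul_le_mul_of_nonneg_left (mul_rpow_mul_rpow_le measureReal_nonneg measureReal_nonneg hv
    (hα.trans hr') (hβ.trans hr')) (mul_nonneg (Nat.cast_nonneg _)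
      (offsetConst_nonneg (by positivity) r r'))

theorem proposition1p3 (r r' : ℝ) (hr : 2 < r) (hrr' : r.HolderConjugate r') :
    ∃ (N : ℝ → ℝ → ℕ) (K : ℝ → ℝ → ℝ → ℝ → ℝ),
      ∀ F G H : Set ℝ, MeasurableSet F → MeasurableSet G → MeasurableSet H →
        volume F < ∞ → volume G < ∞ → volume H = 1 →
        ∃ H' : Set ℝ, MeasurableSet H' ∧ H' ⊆ H ∧ volume H / 2 < volume H' ∧
          ∀ p q s : ℝ, r' < p → r' < q → r' / 2 < s → s < r → 1 / p + 1 / q = 1 / s →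
          ∀ (B C : ℝ) (W : Set BilinearRdF.DyadicSquare) (S : Finset BilinearRdF.Tritile)
            (φ : BilinearRdF.Tritile → Fin 3 → ℝ → ℂ),
            BilinearRdF.IsModel B C (N p q) W S φ →
          ∀ (f g : ℝ → ℂ) (h : BilinearRdF.DyadicSquare → ℝ → ℂ),
            AEStronglyMeasurable f volume → AEStronglyMeasurable g volume →
            (∀ w ∈ W, AEStronglyMeasurable (h w) volume) →
            (∀ᵐ x, ‖f x‖ ≤ F.indicator 1 x) → (∀ᵐ x, ‖g x‖ ≤ G.indicator 1 x) →
            (∀ᵐ x, (∑' w : W, ‖h w x‖ₑ ^ r') ^ (1 / r') ≤ H'.indicator 1 x) →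
            ‖BilinearRdF.modelForm S φ f g h‖ ≤
              K p q B C * volume.real F ^ (1 / p) * volume.real G ^ (1 / q) *
                volume.real H ^ (1 - 1 / s) := by
  have hr' : 0 < r' := hrr'.symm.pos
  obtain ⟨K, hK⟩ := proposition1p3_general r r' hr hrr'
  refine ⟨fun _ _ => 1, fun _ _ => K, fun F G H hF hG hH hFfin hGfin hvol => ?_⟩
  obtain ⟨H', hH', hsub, hlarge, bound⟩ := hK F G H hF hG hH hFfin hGfin (by simp [hvol])
    (by simp [hvol])
  refine ⟨H', hH', hsub, hlarge, fun p q s hp hq hs hsr hpqs => ?_⟩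
  have hαβ : 1 / r ≤ 1 / p + 1 / q := hpqs ▸ one_div_le_one_div_of_le (by linarith) hsr.le
  simpa only [hpqs, mul_assoc] using bound (1 / p) (1 / q)
    (one_div_pos.2 (hr'.trans hp)).le (one_div_le_one_div_of_le hr' hp.le)
    (one_div_pos.2 (hr'.trans hq)).le (one_div_le_one_div_of_le hr' hq.le) hαβ
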